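/- Let $GL_4(\mathbb{Q})$ act on the rational function field $\mathbb{Q}(x_1,x_2,x_3,x_4)$ by $\mathbb{Q}$-automorphisms via $g\cdot x_j=\sum_{i=1}^4 g_{ij}x_i$ for $g=(g_{ij})$, and for a subgroup $G\le GL_4(\mathbb{Q})$ let $\mathbb{Q}(x_1,x_2,x_3,x_4)^G$ be the fixed field. Put $$\sigma=\begin{pmatrix}0&0&0&-1\\1&0&0&-1\\0&1&0&-1\\0&0&1&-1\end{pmatrix},\quad \tau_1=\begin{pmatrix}0&1&0&0\\1&0&0&0\\0&0&1&0\\0&0&0&1\end{pmatrix},\quad \tau_2=-\tau_1,\quad \tau_3=\begin{pmatrix}0&0&1&0\\1&0&0&0\\0&1&0&0\\0&0&0&1\end{pmatrix},\quad \lambda=-I_4,$$ and consider the five groups $$G_3=\langle\sigma,\tau_3\rangle,\quad G_4=\langle\sigma,\tau_1\rangle,\quad G_5=\langle\sigma,\tau_2\rangle,\quad G_6=\langle\sigma,\tau_3,\lambda\rangle,\quad G_7=\langle\sigma,\tau_1,\lambda\rangle$$ ($G_4$ is the image of the $4$-dimensional standard representation of $S_5$, $G_3$ that of its restriction to $A_5$,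 $G_5$ that of its twist by the sign character). They represent the five conjugacy classes of finite subgroups of $GL_4(\mathbb{Q})$ denoted $(4,31,3)$, $(4,31,4)$, $(4,31,5)$, $(4,31,6)$, $(4,31,7)$ in the book of Brown, Bülow, Neubüser, Wondratschek and Zassenhaus. **Theorem A1.** Let $G$ be a subgroup of $GL_4(\mathbb{Q})$. 1. $G\cong A_5$ if and only if $G$ is conjugate in $GL_4(\mathbb{Q})$ to $G_3$; $G\cong S_5$ if and only if $G$ is conjugate to $G_4$ or to $G_5$; $G\cong A_5\times C_2$ if and only if $G$ is conjugate to $G_6$; $G\cong S_5\times C_2$ if and only if $G$ is conjugate to $G_7$. 2. If $G$ is conjugate in $GL_4(\mathbb{Q})$ to one of $G_3,\dots,G_7$ (equivalently, if $G$ is isomorphic as an abstract group to one of $A_5$, $S_5$, $A_5\times C_2$, $S_5\times C_2$), then $\mathbb{Q}(x_1,x_2,x_3,x_4)^G$ is rational (that is, purely transcendental) over $\mathbb{Q}$. -/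

import Mathlib

open MvPolynomial

namespace FourDimLinear

noncomputable section

/-- The group `GL_4(ℚ)`. -/
abbrev GL4 : Type := Matrix.GeneralLinearGroup (Fin 4) ℚ

/-- The rational function field `ℚ(x_1, x_2, x_3, x_4)`. -/
abbrev RatFun4 : Type := FractionRing (MvPolynomial (Fin 4) ℚ)

/-- The linear substitution `x_j ↦ ∑ i, a_{ij} x_i` of a matrix `a = (a_{ij})` on polynomials. -/
def linSubst (a : Matrix (Fin 4) (Fin 4) ℚ) :
    MvPolynomial (Fin 4) ℚ →ₐ[ℚ] MvPolynomial (Fin 4) ℚ :=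
  aeval fun j => ∑ i, C (a i j) * X i

theorem linSubst_X (a : Matrix (Fin 4) (Fin 4) ℚ) (j : Fin 4) :
    linSubst a (X j) = ∑ i, C (a i j) * X i := by
  simp [linSubst]

theorem linSubst_one : linSubst 1 = AlgHom.id ℚ _ := by
  ext1 j
  rw [linSubst_X]
  simp [Matrix.one_apply]

theorem linSubst_mul (a b : Matrix (Fin 4) (Fin 4) ℚ) :
    linSubst (a * b) = (linSubst a).comp (linSubst b) := by
  ext1 j
  rw [AlgHom.comp_apply, linSubst_X, linSubst_X, map_sum]
  have h : ∀ i, linSubst a (C (b i j) * X i) = ∑ k, C (a k i) * C (b i j) * X k := by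
    intro i
    rw [map_mul, linSubst_X, ← algebraMap_eq, AlgHom.commutes, Finset.mul_sum]
    exact Finset.sum_congr rfl fun k _ => by ring
  simp only [h, Matrix.mul_apply, map_sum, map_mul, Finset.sum_mul]
  exact Finset.sum_comm

/-- The action of `GL_4(ℚ)` on the polynomial ring by `ℚ`-algebra automorphisms. -/
def polyAction : GL4 →* (MvPolynomial (Fin 4) ℚ ≃ₐ[ℚ] MvPolynomial (Fin 4) ℚ) where
  toFun g := AlgEquiv.ofAlgHom (linSubst g.val) (linSubst g⁻¹.val)
    (by rw [← linSubst_mul, ← Units.val_mul, mul_inv_cancel, Units.val_one, linSubst_one])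
    (by rw [← linSubst_mul, ← Units.val_mul, inv_mul_cancel, Units.val_one, linSubst_one])
  map_one' := by
    ext1 p
    change linSubst 1 p = p
    rw [linSubst_one, AlgHom.id_apply]
  map_mul' g h := by
    ext1 p
    change linSubst (g.val * h.val) p = linSubst g.val (linSubst h.val p)
    rw [linSubst_mul, AlgHom.comp_apply]

/-- The action of `GL_4(ℚ)` on `ℚ(x_1, x_2, x_3, x_4)` by `ℚ`-automorphisms, determined by
`g · x_j = ∑ i, g_{ij} x_i`. -/
def fieldAction : GL4 →* (RatFun4 ≃ₐ[ℚ] RatFun4) :=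
  (IsFractionRing.fieldEquivOfAlgEquivHom ℚ RatFun4).comp polyAction

theorem fieldAction_algebraMap (g : GL4) (p : MvPolynomial (Fin 4) ℚ) :
    fieldAction g (algebraMap (MvPolynomial (Fin 4) ℚ) RatFun4 p) =
      algebraMap (MvPolynomial (Fin 4) ℚ) RatFun4 (linSubst g.val p) :=
  IsFractionRing.fieldEquivOfAlgEquiv_algebraMap ℚ RatFun4 RatFun4 (polyAction g) p

theorem fieldAction_X (g : GL4) (j : Fin 4) :
    fieldAction g (algebraMap (MvPolynomial (Fin 4) ℚ) RatFun4 (X j)) =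
      ∑ i, algebraMap ℚ RatFun4 (g.val i j) *
        algebraMap (MvPolynomial (Fin 4) ℚ) RatFun4 (X i) := by
  rw [fieldAction_algebraMap, linSubst_X, map_sum]
  refine Finset.sum_congr rfl fun i _ => ?_
  rw [map_mul, ← algebraMap_eq, ← IsScalarTower.algebraMap_apply]

/-- The fixed field `ℚ(x_1, x_2, x_3, x_4)^G` of a subgroup `G` of `GL_4(ℚ)`. -/
def fixedSubfield (G : Subgroup GL4) : IntermediateField ℚ RatFun4 :=
  IntermediateField.fixedField (G.map fieldAction)

theorem mem_fixedSubfield (G : Subgroup GL4) (f : RatFun4) :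
    f ∈ fixedSubfield G ↔ ∀ g ∈ G, fieldAction g f = f := by
  simp [fixedSubfield]

/-- The extension `L/k` is rational: `L = k(t_1, …, t_n)` for finitely many elements `t_i` that
are algebraically independent over `k`. -/
def IsRational (k L : Type*) [Field k] [Field L] [Algebra k L] : Prop :=
  ∃ (n : ℕ) (t : Fin n → L),
    AlgebraicIndependent k t ∧ IntermediateField.adjoin k (Set.range t) = ⊤

/-- `G` and `H` are conjugate subgroups of `GL_4(ℚ)`. -/
def AreConjugate (G H : Subgroup GL4) : Prop :=
  ∃ g : GL4, G = H.map (MulAut.conj g).toMonoidHom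

/-- The matrix of the 5-cycle `e_1 ↦ e_2 ↦ e_3 ↦ e_4 ↦ e_5 ↦ e_1` on the quotient of `ℚ^5` by the
line spanned by `e_1 + e_2 + e_3 + e_4 + e_5`, in the basis `e_1, e_2, e_3, e_4`. -/
def sigma : GL4 where
  val := !![0, 0, 0, -1; 1, 0, 0, -1; 0, 1, 0, -1; 0, 0, 1, -1]
  inv := !![-1, 1, 0, 0; -1, 0, 1, 0; -1, 0, 0, 1; -1, 0, 0, 0]
  val_inv := by ext i j; fin_cases i <;> fin_cases j <;> simp [Matrix.mul_apply, Fin.sum_univ_four]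
  inv_val := by ext i j; fin_cases i <;> fin_cases j <;> simp [Matrix.mul_apply, Fin.sum_univ_four]

/-- The matrix of the transposition `(1, 2)`. -/
def tau1 : GL4 where
  val := !![0, 1, 0, 0; 1, 0, 0, 0; 0, 0, 1, 0; 0, 0, 0, 1]
  inv := !![0, 1, 0, 0; 1, 0, 0, 0; 0, 0, 1, 0; 0, 0, 0, 1]
  val_inv := by ext i j; fin_cases i <;> fin_cases j <;> simp [Matrix.mul_apply, Fin.sum_univ_four]
  inv_val := by ext i j; fin_cases i <;> fin_cases j <;> simp [Matrix.mul_apply, Fin.sum_univ_four]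

/-- The negative of the matrix of the transposition `(1, 2)`. -/
def tau2 : GL4 where
  val := !![0, -1, 0, 0; -1, 0, 0, 0; 0, 0, -1, 0; 0, 0, 0, -1]
  inv := !![0, -1, 0, 0; -1, 0, 0, 0; 0, 0, -1, 0; 0, 0, 0, -1]
  val_inv := by ext i j; fin_cases i <;> fin_cases j <;> simp [Matrix.mul_apply, Fin.sum_univ_four]
  inv_val := by ext i j; fin_cases i <;> fin_cases j <;> simp [Matrix.mul_apply, Fin.sum_univ_four]

/-- The matrix of the 3-cycle `(1, 2, 3)`. -/
def tau3 : GL4 where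
  val := !![0, 0, 1, 0; 1, 0, 0, 0; 0, 1, 0, 0; 0, 0, 0, 1]
  inv := !![0, 1, 0, 0; 0, 0, 1, 0; 1, 0, 0, 0; 0, 0, 0, 1]
  val_inv := by ext i j; fin_cases i <;> fin_cases j <;> simp [Matrix.mul_apply, Fin.sum_univ_four]
  inv_val := by ext i j; fin_cases i <;> fin_cases j <;> simp [Matrix.mul_apply, Fin.sum_univ_four]

/-- The scalar matrix `-1`. -/
def lam : GL4 where
  val := !![-1, 0, 0, 0; 0, -1, 0, 0; 0, 0, -1, 0; 0, 0, 0, -1]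
  inv := !![-1, 0, 0, 0; 0, -1, 0, 0; 0, 0, -1, 0; 0, 0, 0, -1]
  val_inv := by ext i j; fin_cases i <;> fin_cases j <;> simp [Matrix.mul_apply, Fin.sum_univ_four]
  inv_val := by ext i j; fin_cases i <;> fin_cases j <;> simp [Matrix.mul_apply, Fin.sum_univ_four]

/-- The group of the ℚ-class `(4, 31, 3)`: the standard representation restricted to `A_5`. -/
def G3 : Subgroup GL4 := Subgroup.closure {sigma, tau3}

/-- The group of the ℚ-class `(4, 31, 4)`: the standard representation of `S_5`. -/
def G4 : Subgroup GL4 := Subgroup.closure {sigma, tau1}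

/-- The group of the ℚ-class `(4, 31, 5)`: the standard representation of `S_5` tensored with the
sign character. -/
def G5 : Subgroup GL4 := Subgroup.closure {sigma, tau2}

/-- The group of the ℚ-class `(4, 31, 6)`. -/
def G6 : Subgroup GL4 := Subgroup.closure {sigma, tau3, lam}

/-- The group of the ℚ-class `(4, 31, 7)`. -/
def G7 : Subgroup GL4 := Subgroup.closure {sigma, tau1, lam}

/-- The cyclic group of order two. -/
abbrev C2 : Type := Multiplicative (ZMod 2)

/-- The symmetric group of degree five. -/
abbrev S5 : Type := Equiv.Perm (Fin 5)

/-- The alternating group of degree five. -/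
abbrev A5 : Type := alternatingGroup (Fin 5)

end

end FourDimLinear

/-! Classification. All five groups are images of subgroups of `S5 × ℤˣ` under `signedStd`.
Conversely, let `S_5` or `A_5` act faithfully on `ℚ^4`. A trace count shows that the Klein
four-group of `A_4` fixes exactly a line; a 3-cycle acts on it by a rational cube root of unity,
hence trivially, so `A_4` fixes a vector `v` (`exists_fixed_vector`). The 5-cycle has minimal
polynomial `Φ_5`, so the translates of `v` under its powers span `ℚ^4`, have sum zero and are
permuted like the five points: this is the standard representation (`exists_conj_std`). For `S_5`, a
transposition fixes or negates `v`, which separates the standard representation from its sign twist.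
A further central involution commutes with an absolutely irreducible image, so it is `-1`.

Rationality. Conjugate groups have isomorphic fixed fields, and any four generators of a fixed field
are algebraically independent because the transcendence degree is four. With `x_1, …, x_5` of sum
zero, `G4` has the fixed field `ℚ(e2, e3, e4, e5)`, and `G3` has this field with `Δ = delta root`
adjoined. `G7` and `G5` follow by descent along the sign of `e3`. For `G5`, `Δ²` is a power of `e2`
times a function of weight zero, so an equation linear in `e2` recovers `e2` from weight-zero
functions and `e3 Δ / e2^6`.

For `G3` the same device is applied to Sylvester's form of the quintic, `∑ κ_i (X - r_i)^5`. In its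
coordinates `k, p, q, n` the discriminant is `3125 (J² - 128 H² S)`, where `H, S, J` are essentially
symmetric functions of three conjugates `α_i` over the field of symmetric functions. Once the `α_i`
are scaled to have sum one, `H² S / J²` is linear in their second symmetric function when `P =
dJ/S²` is given, so `P` and `Δ/J` determine the cubic of the `α_i`. The `α_i` and the roots `y_i` of
the cubic `Y³ + pY + q` generate the same cubic algebra and so are related by a Möbius
transformation; its two remaining scaled parameters complete the generators (`rat_mem_of_gen_mem`).
Under `-1` only the last generator changes sign, so squaring it gives `G6`. -/

open MvPolynomial

namespace FourDimLinear

open Equiv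

/-! ### The standard representation of the symmetric group -/

/-- The images in `ℚ^5 / ℚ(1, …, 1)` of the standard basis vectors of `ℚ^5`. -/
def stdVec (i : Fin 5) : Fin 4 → ℚ := fun k =>
  (if i = k.castSucc then 1 else 0) - (if i = Fin.last 4 then 1 else 0)

/-- The matrix of a permutation on `ℚ^5 / ℚ(1, …, 1)`. -/
def stdMatrix (s : S5) : Matrix (Fin 4) (Fin 4) ℚ :=
  Matrix.of fun k j => stdVec (s j.castSucc) k

theorem sum_stdVec : ∑ i, stdVec i = 0 := by
  ext k
  simp [stdVec]

theorem stdVec_castSucc (j : Fin 4) : stdVec j.castSucc = Pi.single j 1 := by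
  ext k
  rw [stdVec, if_neg (Fin.castSucc_ne_last j)]
  simp [Pi.single_apply, eq_comm]

theorem stdVec_last : stdVec (Fin.last 4) = -∑ j : Fin 4, stdVec j.castSucc := by
  have h := sum_stdVec
  rw [Fin.sum_univ_castSucc] at h
  exact eq_neg_of_add_eq_zero_right h

theorem stdMatrix_mulVec (s : S5) (i : Fin 5) :
    (stdMatrix s).mulVec (stdVec i) = stdVec (s i) := by
  have h (j : Fin 4) :
      (stdMatrix s).mulVec (stdVec j.castSucc) = stdVec (s j.castSucc) := by
    rw [stdVec_castSucc, Matrix.mulVec_single_one]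
    rfl
  induction i using Fin.lastCases with
  | cast j => exact h j
  | last =>
    rw [stdVec_last, Matrix.mulVec_neg, Matrix.mulVec_sum, Finset.sum_congr rfl fun j _ => h j]
    have h := Equiv.sum_comp s stdVec
    rw [sum_stdVec, Fin.sum_univ_castSucc] at h
    exact (eq_neg_of_add_eq_zero_right h).symm

theorem mul_stdMatrix_ext {M M' : Matrix (Fin 4) (Fin 4) ℚ}
    (h : ∀ i, M.mulVec (stdVec i) = M'.mulVec (stdVec i)) : M = M' := by
  refine Matrix.ext_of_mulVec_single fun j => ?_
  rw [← stdVec_castSucc]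
  exact h _

theorem stdMatrix_one : stdMatrix 1 = 1 :=
  mul_stdMatrix_ext fun i => by rw [stdMatrix_mulVec, Matrix.one_mulVec, Perm.one_apply]

theorem stdMatrix_mul (s t : S5) : stdMatrix (s * t) = stdMatrix s * stdMatrix t :=
  mul_stdMatrix_ext fun i => by
    rw [← Matrix.mulVec_mulVec, stdMatrix_mulVec, stdMatrix_mulVec, stdMatrix_mulVec,
      Perm.mul_apply]

/-- The standard representation `S_5 → GL_4(ℚ)`. -/
def std : S5 →* GL4 :=
  MonoidHom.toHomUnits
    { toFun := stdMatrix, map_one' := stdMatrix_one, map_mul' := stdMatrix_mul }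

@[simp] theorem val_std (s : S5) : (std s).val = stdMatrix s := rfl

/-- The scalar matrices `±1`. -/
def scal : ℤˣ →* GL4 := Units.map (Int.castRingHom (Matrix (Fin 4) (Fin 4) ℚ)).toMonoidHom

theorem val_scal (u : ℤˣ) : (scal u).val = ((u : ℤ) : Matrix (Fin 4) (Fin 4) ℚ) := rfl

@[simp] theorem val_scal_neg_one : (scal (-1)).val = -1 := by
  simp [val_scal]

theorem scal_comm (u : ℤˣ) (g : GL4) : Commute (scal u) g := by
  ext1
  exact Int.cast_commute (u : ℤ) g.val

/-- The product of the standard representation with the scalars `±1`. -/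
def signedStd : S5 × ℤˣ →* GL4 :=
  MonoidHom.noncommCoprod std scal fun _ _ => (scal_comm _ _).symm

theorem signedStd_apply (x : S5 × ℤˣ) : signedStd x = std x.1 * scal x.2 := rfl

theorem stdVec_injective : Function.Injective stdVec := by
  decide +kernel

theorem stdVec_ne_neg (i j : Fin 5) : stdVec i ≠ -stdVec j := by
  revert i j
  decide +kernel

theorem signedStd_mulVec (s : S5) (u : ℤˣ) (i : Fin 5) :
    (signedStd (s, u)).val.mulVec (stdVec i) = (u : ℤ) • stdVec (s i) := by
  rw [signedStd_apply, Units.val_mul, val_std, val_scal, ← (Int.cast_commute _ _).eq,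
    ← Matrix.mulVec_mulVec, stdMatrix_mulVec]
  rcases Int.units_eq_one_or u with rfl | rfl <;> simp [Matrix.neg_mulVec]

/-- The ten vectors `±stdVec i` are distinct, so their images determine both the permutation and the
sign. -/
theorem signedStd_injective : Function.Injective signedStd := by
  rw [injective_iff_map_eq_one]
  rintro ⟨s, u⟩ h
  have h' (i : Fin 5) : (u : ℤ) • stdVec (s i) = stdVec i := by
    rw [← signedStd_mulVec, h, Units.val_one, Matrix.one_mulVec]
  rcases Int.units_eq_one_or u with rfl | rfl
  · have : s = 1 := Equiv.ext fun i => stdVec_injective (by simpa using h' i)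
    rw [this]; rfl
  · exact absurd (by simpa using (h' 0).symm) (stdVec_ne_neg 0 (s 0))

/-! ### The five groups as images -/

/-- The permutation `(1, 2, 3)`. -/
def threeCycle : S5 := swap 0 1 * swap 1 2

theorem std_finRotate : std (finRotate 5) = sigma := by
  ext1
  change stdMatrix (finRotate 5) = sigma.val
  decide +kernel

theorem std_swap : std (swap 0 1) = tau1 := by
  ext1
  change stdMatrix (swap 0 1) = tau1.val
  decide +kernel

theorem std_threeCycle : std threeCycle = tau3 := by
  ext1
  change stdMatrix threeCycle = tau3.val
  decide +kernel

theorem scal_neg_one : scal (-1) = lam := by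
  ext1
  rw [val_scal_neg_one]
  decide +kernel

theorem tau2_eq : tau2 = tau1 * scal (-1) := by
  ext1
  rw [Units.val_mul, val_scal_neg_one, mul_neg_one]
  change tau2.val = -tau1.val
  decide +kernel

theorem sign_finRotate_five : Perm.sign (finRotate 5) = 1 := by decide

theorem sign_threeCycle : Perm.sign threeCycle = 1 := by decide

/-- A transitive group of prime degree is primitive, and by Jordan's theorem a primitive group
containing a 3-cycle contains the alternating group. -/
theorem closure_eq_alternatingGroup :
    Subgroup.closure {finRotate 5, threeCycle} = alternatingGroup (Fin 5) := by
  refine le_antisymm ((Subgroup.closure_le _).2 ?_) ?_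
  · rintro x (rfl | rfl)
    · exact sign_finRotate_five
    · exact sign_threeCycle
  · have hc : finRotate 5 ∈ Subgroup.closure {finRotate 5, threeCycle} :=
      Subgroup.subset_closure (by simp)
    have ht : threeCycle ∈ Subgroup.closure {finRotate 5, threeCycle} :=
      Subgroup.subset_closure (by simp)
    have hp : MulAction.IsPretransitive (Subgroup.closure {finRotate 5, threeCycle}) (Fin 5) := by
      have (i : Fin 5) : (finRotate 5 ^ (i : ℕ)) 0 = i := by revert i; decide
      refine MulAction.IsPretransitive.of_orbit (x₀ := 0) fun i =>
        ⟨⟨finRotate 5 ^ (i : ℕ), pow_mem hc _⟩, this i⟩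
    refine Perm.alternatingGroup_le_of_isPreprimitive_of_isThreeCycle_mem
      (MulAction.IsPreprimitive.of_prime_card (by rw [Nat.card_eq_fintype_card, Fintype.card_fin]; norm_num)) (g := threeCycle) ?_ ht
    exact Perm.isThreeCycle_swap_mul_swap_same (a := (1 : Fin 5)) (b := 0) (c := 2)
      (by decide) (by decide) (by decide) |> fun h => by
        simpa [threeCycle, swap_comm] using h

theorem closure_eq_top : Subgroup.closure {finRotate 5, swap (0 : Fin 5) 1} = ⊤ :=
  Perm.closure_cycle_adjacent_swap (isCycle_finRotate) (support_finRotate) (0 : Fin 5)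

end FourDimLinear

/-! ### The five groups as images of subgroups of `S5 × ℤˣ`. -/

namespace FourDimLinear

open Equiv

/-- `S_5 → S_5 × {±1}`, the graph of the sign. -/
def signGraph : S5 →* S5 × ℤˣ := (MonoidHom.id S5).prod Perm.sign

/-- The inclusion of `A_5 × {±1}` into `S_5 × {±1}`. -/
def altProd : A5 × ℤˣ →* S5 × ℤˣ := (alternatingGroup (Fin 5)).subtype.prodMap (MonoidHom.id ℤˣ)

/-- The inclusion of `A_5` into `S_5 × {±1}`. -/
def altInl : A5 →* S5 × ℤˣ := altProd.comp (MonoidHom.inl A5 ℤˣ)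

theorem altProd_apply (x : A5 × ℤˣ) : altProd x = (x.1.val, x.2) := rfl

theorem signGraph_apply (s : S5) : signGraph s = (s, Perm.sign s) := rfl

theorem signedStd_inl : signedStd.comp (MonoidHom.inl S5 ℤˣ) = std := by
  ext1 s
  simp [signedStd_apply]

theorem signedStd_altInl : signedStd.comp altInl = std.comp (alternatingGroup (Fin 5)).subtype := by
  ext1 s
  simp [signedStd_apply, altInl, altProd_apply]

theorem G3_eq : G3 = (signedStd.comp altInl).range := by
  rw [signedStd_altInl, MonoidHom.range_comp, Subgroup.range_subtype,
    ← closure_eq_alternatingGroup, MonoidHom.map_closure, Set.image_pair, std_finRotate,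
    std_threeCycle, G3]

theorem G4_eq : G4 = (signedStd.comp (MonoidHom.inl S5 ℤˣ)).range := by
  rw [signedStd_inl, MonoidHom.range_eq_map, ← closure_eq_top, MonoidHom.map_closure,
    Set.image_pair, std_finRotate, std_swap, G4]

theorem G5_eq : G5 = (signedStd.comp signGraph).range := by
  have h1 : (signedStd.comp signGraph) (finRotate 5) = sigma := by
    rw [MonoidHom.comp_apply, signGraph_apply, signedStd_apply, sign_finRotate_five, map_one,
      mul_one, std_finRotate]
  have h2 : (signedStd.comp signGraph) (swap 0 1) = tau2 := by
    rw [MonoidHom.comp_apply, signGraph_apply, signedStd_apply, Perm.sign_swap (by decide),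
      std_swap, tau2_eq]
  rw [MonoidHom.range_eq_map, ← closure_eq_top, MonoidHom.map_closure,
    Set.image_pair, h1, h2, G5]

theorem scal_mem {H : Subgroup GL4} (h : lam ∈ H) (u : ℤˣ) : scal u ∈ H := by
  rcases Int.units_eq_one_or u with rfl | rfl
  · rw [map_one]; exact H.one_mem
  · rwa [scal_neg_one]

theorem G6_eq : G6 = (signedStd.comp altProd).range := by
  refine le_antisymm ((Subgroup.closure_le _).2 ?_) ?_
  · rintro x (rfl | rfl | rfl)
    · exact ⟨(⟨finRotate 5, sign_finRotate_five⟩, 1), by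
        simp [signedStd_apply, altProd_apply, std_finRotate]⟩
    · exact ⟨(⟨threeCycle, sign_threeCycle⟩, 1), by
        simp [signedStd_apply, altProd_apply, std_threeCycle]⟩
    · exact ⟨(1, -1), by simp [signedStd_apply, altProd_apply, scal_neg_one]⟩
  · rintro x ⟨⟨s, u⟩, rfl⟩
    refine mul_mem ?_ (scal_mem (Subgroup.subset_closure (by simp)) u)
    have h : std s ∈ G3 := by
      rw [G3_eq, signedStd_altInl]
      exact ⟨s, rfl⟩
    exact Subgroup.closure_mono (by grind) h

theorem G7_eq : G7 = signedStd.range := by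
  refine le_antisymm ((Subgroup.closure_le _).2 ?_) ?_
  · rintro x (rfl | rfl | rfl)
    · exact ⟨(finRotate 5, 1), by simp [signedStd_apply, std_finRotate]⟩
    · exact ⟨(swap 0 1, 1), by simp [signedStd_apply, std_swap]⟩
    · exact ⟨(1, -1), by simp [signedStd_apply, scal_neg_one]⟩
  · rintro x ⟨⟨s, u⟩, rfl⟩
    refine mul_mem ?_ (scal_mem (Subgroup.subset_closure (by simp)) u)
    have h : std s ∈ G4 := by
      rw [G4_eq, signedStd_inl]
      exact ⟨s, rfl⟩
    exact Subgroup.closure_mono (by grind) h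

theorem altProd_injective : Function.Injective altProd :=
  Function.Injective.prodMap Subtype.val_injective Function.injective_id

theorem altInl_injective : Function.Injective altInl :=
  altProd_injective.comp (Prod.mk_left_injective 1)

theorem signGraph_injective : Function.Injective signGraph := fun _ _ h => congrArg Prod.fst h

/-- The multiplicative group `{±1}` is cyclic of order two. -/
theorem nonempty_C2_equiv : Nonempty (C2 ≃* ℤˣ) :=
  ⟨mulEquivOfPrimeCardEq (p := 2) (by simp) (by simp)⟩

theorem AreConjugate.nonempty_equiv {G : Subgroup GL4} {K : Type*} [Group K] {f : K →* GL4}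
    (hf : Function.Injective f) (h : AreConjugate G f.range) : Nonempty (G ≃* K) := by
  obtain ⟨g, rfl⟩ := h
  exact ⟨(f.range.equivMapOfInjective _ (MulAut.conj g).injective).symm.trans
    (MonoidHom.ofInjective hf).symm⟩

/-- Only the images have to match, so `j` may be any surjection. This lets the sign-twisted
representation of `S_5 × C_2` have the same image as the untwisted one. -/
theorem areConjugate_range {G : Subgroup GL4} {K K' : Type*} [Group K] [Group K'] (e : K ≃* G)
    {f : K' →* GL4} (j : K → K') (hj : Function.Surjective j) (B : GL4)
    (h : ∀ x, (e x : GL4) = B * f (j x) * B⁻¹) :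
    AreConjugate G f.range := by
  refine ⟨B, le_antisymm (fun g hg => ?_) ?_⟩
  · have := h (e.symm ⟨g, hg⟩)
    rw [e.apply_symm_apply] at this
    exact ⟨_, ⟨_, rfl⟩, this.symm⟩
  · rintro _ ⟨_, ⟨y, rfl⟩, rfl⟩
    obtain ⟨x, rfl⟩ := hj y
    have := (e x).2
    rwa [h x] at this

end FourDimLinear

namespace FourDimLinear

open Equiv

/-! ### Rational matrices of order five -/

section OrderFive

variable {M : Matrix (Fin 4) (Fin 4) ℚ}

/-- The matrix with columns `M v, M² v, M³ v, M⁴ v`. -/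
def krylov (M : Matrix (Fin 4) (Fin 4) ℚ) (v : Fin 4 → ℚ) : Matrix (Fin 4) (Fin 4) ℚ :=
  Matrix.of fun k i => (M ^ ((i : ℕ) + 1)).mulVec v k

/-- `Φ_5` is irreducible of degree four, hence coprime to `p`; a Bézout relation applied to `v`
would give `v = 0`. -/
theorem aeval_mulVec_ne_zero {v : Fin 4 → ℚ} (hv : v ≠ 0)
    (h : (Polynomial.aeval M (Polynomial.cyclotomic 5 ℚ)).mulVec v = 0) {p : Polynomial ℚ}
    (hp : p ≠ 0) (hd : p.degree < 4) : (Polynomial.aeval M p).mulVec v ≠ 0 := by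
  intro h0
  have hirr : Irreducible (Polynomial.cyclotomic 5 ℚ) :=
    Polynomial.cyclotomic.irreducible_rat (by norm_num)
  have hc : IsCoprime (Polynomial.cyclotomic 5 ℚ) p := by
    refine (hirr.coprime_iff_not_dvd).2 fun hdvd => ?_
    have h1 := Polynomial.degree_le_of_dvd hdvd hp
    rw [Polynomial.degree_cyclotomic, Nat.totient_prime (by norm_num)] at h1
    exact absurd hd (not_lt.2 (by simpa using h1))
  obtain ⟨a, b, hab⟩ := hc
  have h2 := congrArg (fun q => (Polynomial.aeval M q).mulVec v) hab
  simp only [map_add, map_mul, map_one, Matrix.add_mulVec, ← Matrix.mulVec_mulVec, h, h0,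
    Matrix.mulVec_zero, add_zero, Matrix.one_mulVec] at h2
  exact hv h2.symm

theorem isUnit_krylov {v : Fin 4 → ℚ} (hM : M ^ 5 = 1) (hv : v ≠ 0)
    (h : (Polynomial.aeval M (Polynomial.cyclotomic 5 ℚ)).mulVec v = 0) :
    IsUnit (krylov M v) := by
  rw [← Matrix.linearIndependent_cols_iff_isUnit, Fintype.linearIndependent_iff]
  intro g hg
  let p : Polynomial ℚ := ∑ i : Fin 4, Polynomial.C (g i) * Polynomial.X ^ (i : ℕ)
  have hMv : M.mulVec v ≠ 0 := by
    intro h0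
    apply hv
    rw [← Matrix.one_mulVec v, ← hM, pow_succ, ← Matrix.mulVec_mulVec, h0, Matrix.mulVec_zero]
  have hMv' : (Polynomial.aeval M (Polynomial.cyclotomic 5 ℚ)).mulVec (M.mulVec v) = 0 := by
    have := ((Polynomial.commute_X (Polynomial.cyclotomic 5 ℚ)).map (Polynomial.aeval M)).eq
    rw [Polynomial.aeval_X] at this
    rw [Matrix.mulVec_mulVec, ← this, ← Matrix.mulVec_mulVec, h, Matrix.mulVec_zero]
  have hpd : p.degree < 4 := by
    refine (Polynomial.degree_sum_le _ _).trans_lt ((Finset.sup_lt_iff (WithBot.bot_lt_coe 4)).2 fun i _ => ?_)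
    refine (Polynomial.degree_C_mul_X_pow_le _ _).trans_lt ?_
    exact_mod_cast i.2
  have hp0 : p = 0 := by
    by_contra hp
    refine aeval_mulVec_ne_zero hMv hMv' hp hpd ?_
    rw [← hg, map_sum, Matrix.sum_mulVec]
    refine Finset.sum_congr rfl fun i _ => ?_
    ext k
    rw [map_mul, map_pow, Polynomial.aeval_C, Polynomial.aeval_X, ← Algebra.smul_def,
      Matrix.smul_mulVec, Matrix.mulVec_mulVec, ← pow_succ]
    rfl
  intro i
  have := congrArg (fun q => Polynomial.coeff q i) hp0
  simpa [p, Polynomial.finsetSum_coeff, Polynomial.coeff_C_mul, Polynomial.coeff_X_pow,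
    Fin.val_inj] using this

/-- Since `(X - 1) Φ_5 = X^5 - 1`, any nonzero `(M - 1) w` is killed by `Φ_5(M)`. Its translates
under powers of `M` already form a basis, and `Φ_5(M)` commutes with `M`, so it kills everything. -/
theorem aeval_cyclotomic_eq_zero (hM : M ^ 5 = 1) (h1 : M ≠ 1) :
    Polynomial.aeval M (Polynomial.cyclotomic 5 ℚ) = 0 := by
  have hw : ∃ w, (M - 1).mulVec w ≠ 0 := by
    by_contra! hw
    exact h1 (sub_eq_zero.1 (Matrix.ext_of_mulVec_single fun i => by
      rw [hw, Matrix.zero_mulVec]))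
  obtain ⟨w, hw⟩ := hw
  set Φ := Polynomial.aeval M (Polynomial.cyclotomic 5 ℚ) with hΦ
  have hsum : Φ = ∑ i ∈ Finset.range 5, M ^ i := by
    have : Fact (Nat.Prime 5) := ⟨by norm_num⟩
    rw [hΦ, Polynomial.cyclotomic_prime, map_sum]
    simp
  have hcomm (n : ℕ) : Commute Φ (M ^ n) := by
    rw [hsum]
    exact Commute.sum_left _ _ _ fun i _ => (Commute.refl M).pow_pow i n
  have h0 : Φ.mulVec ((M - 1).mulVec w) = 0 := by
    rw [Matrix.mulVec_mulVec, hsum, geom_sum_mul, hM, sub_self, Matrix.zero_mulVec]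
  have hu := isUnit_krylov hM hw h0
  refine (hu.mul_left_eq_zero).1 (Matrix.ext_of_mulVec_single fun i => ?_)
  rw [Matrix.zero_mulVec, ← Matrix.mulVec_mulVec, Matrix.mulVec_single_one]
  change Φ.mulVec ((M ^ ((i : ℕ) + 1)).mulVec _) = 0
  rw [Matrix.mulVec_mulVec, (hcomm _).eq, ← Matrix.mulVec_mulVec, h0, Matrix.mulVec_zero]

theorem sum_pow_eq_zero (hM : M ^ 5 = 1) (h1 : M ≠ 1) : ∑ i ∈ Finset.range 5, M ^ i = 0 := by
  have : Fact (Nat.Prime 5) := ⟨by norm_num⟩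
  rw [← aeval_cyclotomic_eq_zero hM h1, Polynomial.cyclotomic_prime, map_sum]
  simp

end OrderFive

/-! ### Recognition of the standard representation -/

theorem finRotate_pow_last (i : Fin 5) : (finRotate 5 ^ ((i : ℕ) + 1)) (Fin.last 4) = i := by
  revert i
  decide

theorem finRotate_pow_five : finRotate 5 ^ 5 = 1 := by
  decide

/-- A representation of a subgroup of `S_5` containing `(1, 2, 3, 4, 5)` is standard if the
stabilizer of a point has a nonzero fixed vector. -/
theorem exists_conj_std {H : Subgroup S5} (hc : finRotate 5 ∈ H) (φ : H →* GL4)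
    (h1 : φ ⟨finRotate 5, hc⟩ ≠ 1) {v : Fin 4 → ℚ} (hv : v ≠ 0)
    (hfix : ∀ h : H, h.val (Fin.last 4) = Fin.last 4 → (φ h).val.mulVec v = v) :
    ∃ B : GL4, ∀ h : H, φ h = B * std h.val * B⁻¹ := by
  set c : H := ⟨finRotate 5, hc⟩ with hcdef
  set M := (φ c).val with hMdef
  have hpow (n : ℕ) : M ^ n = (φ (c ^ n)).val := by rw [map_pow, Units.val_pow_eq_pow_val]
  have hc5 : c ^ 5 = 1 := Subtype.ext finRotate_pow_five
  have hM5 : M ^ 5 = 1 := by rw [hpow, hc5, map_one, Units.val_one]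
  have hM1 : M ≠ 1 := fun h => h1 (Units.ext h)
  have hu := isUnit_krylov hM5 hv
    (by rw [aeval_cyclotomic_eq_zero hM5 hM1, Matrix.zero_mulVec])
  obtain ⟨B, hB⟩ := hu
  have hBcast (j : Fin 4) :
      B.val.mulVec (stdVec j.castSucc) = (M ^ ((j : ℕ) + 1)).mulVec v := by
    rw [hB, stdVec_castSucc, Matrix.mulVec_single_one]
    rfl
  -- The exponent is shifted by one so that the last point corresponds to `M^5 v = v`, the vector
  -- fixed by its stabilizer. The case of the last point is the relation `1 + M + M² + M³ + M⁴ = 0`.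
  have hBv (i : Fin 5) : B.val.mulVec (stdVec i) = (M ^ ((i : ℕ) + 1)).mulVec v := by
    induction i using Fin.lastCases with
    | cast j => exact hBcast j
    | last =>
      rw [stdVec_last, Matrix.mulVec_neg, Matrix.mulVec_sum, Finset.sum_congr rfl fun j _ => hBcast j,
        ← Matrix.sum_mulVec, Fin.val_last, hM5, Matrix.one_mulVec]
      have h := sum_pow_eq_zero hM5 hM1
      rw [Finset.sum_range_succ', pow_zero, ← Fin.sum_univ_eq_sum_range (fun i => M ^ (i + 1))] at h
      rw [eq_neg_of_add_eq_zero_left h, Matrix.neg_mulVec, Matrix.one_mulVec, neg_neg]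
  refine ⟨B, fun h => eq_mul_inv_of_mul_eq (Units.ext (mul_stdMatrix_ext fun i => ?_))⟩
  rw [Units.val_mul, Units.val_mul, ← Matrix.mulVec_mulVec, ← Matrix.mulVec_mulVec, hBv, val_std,
    stdMatrix_mulVec, hBv, hpow, hpow, Matrix.mulVec_mulVec, ← Units.val_mul, ← map_mul]
  -- `c^(i+1)` carries the last point to `i`, so this element stabilizes the last point.
  have h2 := hfix ((c ^ ((h.val i : ℕ) + 1))⁻¹ * (h * c ^ ((i : ℕ) + 1))) (by
    rw [Subgroup.coe_mul, Subgroup.coe_inv, Perm.mul_apply, Perm.inv_eq_iff_eq, Subgroup.coe_pow,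
      Subgroup.coe_mul, Perm.mul_apply, Subgroup.coe_pow, finRotate_pow_last, finRotate_pow_last])
  conv_rhs => rw [← h2]
  rw [Matrix.mulVec_mulVec, ← Units.val_mul, ← map_mul, mul_inv_cancel_left]

end FourDimLinear

namespace FourDimLinear

open Equiv

/-! ### Fixed vectors of the alternating group of degree four -/

theorem exists_natCast_trace_of_idempotent {P : Matrix (Fin 4) (Fin 4) ℚ} (hP : P * P = P) :
    P.trace = (Module.finrank ℚ (LinearMap.range (Matrix.toLin' P)) : ℚ) := by
  have h : IsIdempotentElem (Matrix.toLin' P) := by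
    rw [IsIdempotentElem, Module.End.mul_eq_comp, ← Matrix.toLin'_mul, hP]
  rw [← (LinearMap.IsIdempotentElem.isProj_range _ h).trace, Matrix.trace_toLin'_eq]

/-- `T` permutes `A`, `B`, `AB` cyclically by conjugation, so they share one trace. Comparing the
ranks of the projector `Q/4` onto the fixed space of the four-group and of the projector `(1 - A)/2`
then forces the fixed space to be a line. Whatever commutes with `Q` preserves this line. -/
theorem exists_fixed_of_klein_four {A B T : Matrix (Fin 4) (Fin 4) ℚ} (hA : A * A = 1)
    (hB : B * B = 1) (hAB : B * A = A * B) (hT : T ^ 3 = 1) (hTA : T * A = A * B * T)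
    (hTB : T * B = A * T) (hA1 : A ≠ 1) :
    ∃ v : Fin 4 → ℚ, v ≠ 0 ∧ A.mulVec v = v ∧ B.mulVec v = v ∧ T.mulVec v = v ∧
      ∀ S, Commute S (1 + A + B + A * B) → ∃ c : ℚ, S.mulVec v = c • v := by
  set Q := 1 + A + B + A * B with hQ
  have hAQ : A * Q = Q := by
    rw [hQ]; simp only [mul_add, mul_one, hA, ← mul_assoc, one_mul]; abel
  have hBQ : B * Q = Q := by
    rw [hQ]; simp only [mul_add, mul_one, hB, ← mul_assoc, hAB]
    rw [mul_assoc, hB, mul_one]; abel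
  have hTQ : T * Q = Q * T := by
    have : T * (A * B) = B * T := by
      rw [← mul_assoc, hTA, mul_assoc, hTB, ← mul_assoc, mul_assoc A, hAB, ← mul_assoc, hA, one_mul]
    rw [hQ]; simp only [mul_add, mul_one, hTA, hTB, this, add_mul, one_mul]; abel
  have hT' : T * T ^ 2 = 1 := by rw [← pow_succ', hT]
  have htrAB : (A * B).trace = A.trace := by
    rw [← mul_one (A * B), ← hT', ← mul_assoc, ← hTA, Matrix.trace_mul_comm, ← mul_assoc,
      ← pow_succ, hT, one_mul]
  have htrB : B.trace = A.trace := by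
    rw [← mul_one A, ← hT', ← mul_assoc, ← hTB, Matrix.trace_mul_comm, ← mul_assoc,
      ← pow_succ, hT, one_mul]
  have hP : ((1 / 4 : ℚ) • Q) * ((1 / 4 : ℚ) • Q) = (1 / 4 : ℚ) • Q := by
    have : Q * Q = (4 : ℚ) • Q := by
      conv_lhs => rw [hQ]
      rw [add_mul, add_mul, add_mul, one_mul, hAQ, hBQ, mul_assoc, hBQ, hAQ]
      module
    rw [smul_mul_smul_comm, this, smul_smul]
    norm_num
  have hR : ((1 / 2 : ℚ) • (1 - A)) * ((1 / 2 : ℚ) • (1 - A)) = (1 / 2 : ℚ) • (1 - A) := by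
    rw [smul_mul_smul_comm, mul_sub, sub_mul, sub_mul, hA, one_mul, one_mul, mul_one]
    module
  have hPt := exists_natCast_trace_of_idempotent hP
  have hRt := exists_natCast_trace_of_idempotent hR
  set r := Module.finrank ℚ (LinearMap.range (Matrix.toLin' ((1 / 4 : ℚ) • Q))) with hr
  set n := Module.finrank ℚ (LinearMap.range (Matrix.toLin' ((1 / 2 : ℚ) • (1 - A)))) with hn
  have htr1 : (1 : Matrix (Fin 4) (Fin 4) ℚ).trace = 4 := by simp
  rw [Matrix.trace_smul, hQ, Matrix.trace_add, Matrix.trace_add, Matrix.trace_add, htrAB, htrB,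
    htr1, smul_eq_mul] at hPt
  rw [Matrix.trace_smul, Matrix.trace_sub, htr1, smul_eq_mul] at hRt
  -- With `t` the common trace, `r = (4 + 3t)/4` and `n = (4 - t)/2`. As `n ≠ 0`, the only solution
  -- in natural numbers is `n = 2`, `r = 1`.
  have hrn : (2 * r + 3 * n : ℚ) = 8 := by linarith
  have hn0 : n ≠ 0 := by
    intro h0
    rw [hn, Submodule.finrank_eq_zero, LinearMap.range_eq_bot, LinearEquiv.map_eq_zero_iff,
      smul_eq_zero, sub_eq_zero] at h0
    rcases h0 with h0 | h0
    · norm_num at h0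
    · exact hA1 h0.symm
  have hr1 : r = 1 := by
    have : 2 * r + 3 * n = 8 := by exact_mod_cast hrn
    omega
  obtain ⟨⟨v, hvr⟩, hv0, hv⟩ := finrank_eq_one_iff'.1 (hr.symm.trans hr1)
  obtain ⟨w, hw⟩ := hvr
  rw [Matrix.toLin'_apply] at hw
  have hQv : ((1 / 4 : ℚ) • Q).mulVec v = v := by rw [← hw, Matrix.mulVec_mulVec, hP]
  have hcomm (S : Matrix (Fin 4) (Fin 4) ℚ) (hS : Commute S Q) : ∃ c : ℚ, S.mulVec v = c • v := by
    obtain ⟨c, hc⟩ := hv ⟨S.mulVec v, S.mulVec w, by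
      rw [Matrix.toLin'_apply, ← hw, Matrix.mulVec_mulVec, Matrix.mulVec_mulVec,
        (hS.smul_right (1 / 4 : ℚ)).eq]⟩
    exact ⟨c, (congrArg Subtype.val hc).symm⟩
  have hv0' : v ≠ 0 := fun h => hv0 (Subtype.ext h)
  refine ⟨v, hv0', ?_, ?_, ?_, hcomm⟩
  · conv_lhs => rw [← hQv, Matrix.mulVec_mulVec, Matrix.mul_smul, hAQ, hQv]
  · conv_lhs => rw [← hQv, Matrix.mulVec_mulVec, Matrix.mul_smul, hBQ, hQv]
  · obtain ⟨c, hc⟩ := hcomm T hTQ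
    have h3 : (T ^ 3).mulVec v = (c ^ 3) • v := by
      rw [pow_succ, pow_succ, pow_one, ← Matrix.mulVec_mulVec, hc, Matrix.mulVec_smul,
        ← Matrix.mulVec_mulVec, hc, Matrix.mulVec_smul, hc, smul_smul, smul_smul]
      ring_nf
    rw [hT, Matrix.one_mulVec] at h3
    have hc3 : c ^ 3 = 1 := by
      by_contra hne
      have : (c ^ 3 - 1) • v = 0 := by rw [sub_smul, one_smul, ← h3, sub_self]
      rcases smul_eq_zero.1 this with h | h
      · exact hne (sub_eq_zero.1 h)
      · exact hv0' h
    -- The second factor is `c² + c + 1` with the square completed, which is positive over `ℚ`.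
    have hc1 : c = 1 := by
      have : (c - 1) * ((c + 1 / 2) ^ 2 + 3 / 4) = 0 := by linear_combination hc3
      rcases mul_eq_zero.1 this with h | h
      · linarith
      · nlinarith [sq_nonneg (c + 1 / 2)]
    rw [hc, hc1, one_smul]

/-- The permutation `(1, 2)(3, 4)`. -/
def klein1 : S5 := swap 0 1 * swap 2 3

/-- The permutation `(1, 3)(2, 4)`. -/
def klein2 : S5 := swap 0 2 * swap 1 3

/-- The even permutations fixing the last point form `A_4`, the semidirect product of the four-group
with the group generated by a 3-cycle. -/
theorem exists_eq_of_sign_eq_one {h : S5} (h1 : Perm.sign h = 1) (h4 : h (Fin.last 4) = Fin.last 4) :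
    ∃ i : Fin 2, ∃ j : Fin 2, ∃ k : Fin 3,
      h = klein1 ^ (i : ℕ) * klein2 ^ (j : ℕ) * threeCycle ^ (k : ℕ) := by
  revert h
  decide +kernel

theorem exists_fixed_vector {H : Subgroup S5} (hH : alternatingGroup (Fin 5) ≤ H) {φ : H →* GL4}
    (hφ : Function.Injective φ) :
    ∃ v : Fin 4 → ℚ, v ≠ 0 ∧
      (∀ h : H, Perm.sign h.val = 1 → h.val (Fin.last 4) = Fin.last 4 →
        (φ h).val.mulVec v = v) ∧
      ∀ s : H, s.val = swap 0 1 → ∃ c : ℚ, (φ s).val.mulVec v = c • v := by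
  have ha : klein1 ∈ H := hH (show Perm.sign klein1 = 1 by decide)
  have hb : klein2 ∈ H := hH (show Perm.sign klein2 = 1 by decide)
  have ht : threeCycle ∈ H := hH sign_threeCycle
  have key {x y : H} (h : x.val = y.val) : (φ x).val = (φ y).val := by rw [Subtype.ext h]
  obtain ⟨v, hv0, hAv, hBv, hTv, hS⟩ := exists_fixed_of_klein_four (A := (φ ⟨klein1, ha⟩).val)
    (B := (φ ⟨klein2, hb⟩).val) (T := (φ ⟨threeCycle, ht⟩).val)
    (by rw [← Units.val_mul, ← map_mul, ← Units.val_one, ← map_one φ]; exact key (show klein1 * klein1 = 1 by decide))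
    (by rw [← Units.val_mul, ← map_mul, ← Units.val_one, ← map_one φ]; exact key (show klein2 * klein2 = 1 by decide))
    (by simp only [← Units.val_mul, ← map_mul]; exact key (show klein2 * klein1 = klein1 * klein2 by decide))
    (by rw [← Units.val_pow_eq_pow_val, ← map_pow, ← Units.val_one, ← map_one φ]
        exact key (show threeCycle ^ 3 = 1 by decide))
    (by simp only [← Units.val_mul, ← map_mul]; exact key (show threeCycle * klein1 = klein1 * klein2 * threeCycle by decide))
    (by simp only [← Units.val_mul, ← map_mul]; exact key (show threeCycle * klein2 = klein1 * threeCycle by decide))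
    (fun h => by
      have := congrArg Subtype.val (hφ ((Units.ext h).trans (map_one φ).symm))
      exact absurd (show klein1 = 1 from this) (by decide))
  refine ⟨v, hv0, fun h h1 h4 => ?_, fun s hs => hS _ ?_⟩
  · obtain ⟨i, j, k, hijk⟩ := exists_eq_of_sign_eq_one h1 h4
    have hpow {M : Matrix (Fin 4) (Fin 4) ℚ} (hM : M.mulVec v = v) (n : ℕ) :
        (M ^ n).mulVec v = v := by
      induction n with
      | zero => rw [pow_zero, Matrix.one_mulVec]
      | succ n ih => rw [pow_succ, ← Matrix.mulVec_mulVec, hM, ih]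
    have : h = ⟨klein1, ha⟩ ^ (i : ℕ) * ⟨klein2, hb⟩ ^ (j : ℕ) * ⟨threeCycle, ht⟩ ^ (k : ℕ) :=
      Subtype.ext hijk
    rw [this, map_mul, map_mul, map_pow, map_pow, map_pow, Units.val_mul, Units.val_mul,
      Units.val_pow_eq_pow_val, Units.val_pow_eq_pow_val, Units.val_pow_eq_pow_val,
      ← Matrix.mulVec_mulVec, hpow hTv, ← Matrix.mulVec_mulVec, hpow hBv, hpow hAv]
  · rw [Commute, SemiconjBy]
    have e1 : s * ⟨klein1, ha⟩ = ⟨klein1, ha⟩ * s :=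
      Subtype.ext (by simp only [Subgroup.coe_mul, hs]; decide)
    have e2 : s * ⟨klein2, hb⟩ = ⟨klein1, ha⟩ * ⟨klein2, hb⟩ * s :=
      Subtype.ext (by simp only [Subgroup.coe_mul, hs]; decide)
    have e3 : s * (⟨klein1, ha⟩ * ⟨klein2, hb⟩) = ⟨klein2, hb⟩ * s :=
      Subtype.ext (by simp only [Subgroup.coe_mul, hs]; decide)
    simp only [mul_add, add_mul, mul_one, one_mul, ← Units.val_mul, ← map_mul, e1, e2, e3]
    abel

end FourDimLinear

namespace FourDimLinear

open Equiv

/-! ### Classification of the faithful representations -/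

theorem exists_conj_std_of_A5 {φ : A5 →* GL4} (hφ : Function.Injective φ) :
    ∃ B : GL4, ∀ s : A5, φ s = B * std s.val * B⁻¹ := by
  obtain ⟨v, hv, hfix, -⟩ := exists_fixed_vector le_rfl hφ
  refine exists_conj_std (H := alternatingGroup (Fin 5)) sign_finRotate_five φ
    (fun h => ?_) hv fun h => hfix h h.2
  have := congrArg Subtype.val (hφ (h.trans (map_one φ).symm))
  exact absurd (show finRotate 5 = 1 from this) (by decide)

/-- A transposition in `S_4` normalizes the four-group, so it acts on the fixed line by some `c`
with `c² = 1`. If `c = 1`, all of `S_4` fixes `v`; if `c = -1`, this holds after twisting by the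
sign. -/
theorem exists_conj_std_of_S5 {φ : S5 →* GL4} (hφ : Function.Injective φ) :
    ∃ B : GL4, (∀ s, φ s = B * std s * B⁻¹) ∨ ∀ s, φ s = B * (std s * scal (Perm.sign s)) * B⁻¹ := by
  have hinj : Function.Injective (φ.comp (⊤ : Subgroup S5).subtype) :=
    hφ.comp Subtype.val_injective
  obtain ⟨v, hv, hfix, hs⟩ := exists_fixed_vector le_top hinj
  replace hfix (h : S5) (h1 : Perm.sign h = 1) (h4 : h (Fin.last 4) = Fin.last 4) :
      (φ h).val.mulVec v = v := hfix ⟨h, trivial⟩ h1 h4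
  obtain ⟨c, hc⟩ : ∃ c : ℚ, (φ (swap 0 1)).val.mulVec v = c • v := hs ⟨swap 0 1, trivial⟩ rfl
  have hodd (h : S5) (h1 : Perm.sign h = -1) (h4 : h (Fin.last 4) = Fin.last 4) :
      (φ h).val.mulVec v = c • v := by
    have h2 : h = swap 0 1 * (swap 0 1 * h) := by rw [← mul_assoc, swap_mul_self, one_mul]
    rw [h2, map_mul, Units.val_mul, ← Matrix.mulVec_mulVec, hfix, hc]
    · rw [Perm.sign_mul, h1, Perm.sign_swap (by decide)]; rfl
    · rw [Perm.mul_apply, h4]; decide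
  have hc2 : c * c = 1 := by
    have h2 : ((φ (swap 0 1)).val * (φ (swap 0 1)).val).mulVec v = v := by
      rw [← Units.val_mul, ← map_mul, swap_mul_self, map_one, Units.val_one, Matrix.one_mulVec]
    rw [← Matrix.mulVec_mulVec, hc, Matrix.mulVec_smul, hc, smul_smul] at h2
    have h3 : (c * c - 1) • v = 0 := by rw [sub_smul, h2, one_smul, sub_self]
    exact sub_eq_zero.1 ((smul_eq_zero.1 h3).resolve_right hv)
  have hne {ψ : S5 →* GL4} (hψ : ψ (finRotate 5) = φ (finRotate 5)) :
      (ψ.comp (⊤ : Subgroup S5).subtype) ⟨finRotate 5, trivial⟩ ≠ 1 := fun h => by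
    have := hφ ((hψ.symm.trans h).trans (map_one φ).symm)
    exact absurd this (by decide)
  rcases mul_self_eq_one_iff.1 hc2 with rfl | rfl
  · obtain ⟨B, hB⟩ := exists_conj_std (H := ⊤) trivial (φ.comp (⊤ : Subgroup S5).subtype)
      (hne rfl) hv fun h h4 => by
        rcases Int.units_eq_one_or (Perm.sign h.val) with h1 | h1
        · exact hfix h h1 h4
        · exact (hodd h h1 h4).trans (one_smul _ _)
    exact ⟨B, Or.inl fun s => hB ⟨s, trivial⟩⟩
  · let ψ : S5 →* GL4 :=
      (MonoidHom.noncommCoprod φ scal fun _ _ => (scal_comm _ _).symm).comp signGraph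
    have hψ (s : S5) : ψ s = φ s * scal (Perm.sign s) := rfl
    obtain ⟨B, hB⟩ := exists_conj_std (H := ⊤) trivial (ψ.comp (⊤ : Subgroup S5).subtype)
      (hne (by rw [hψ, sign_finRotate_five, map_one, mul_one])) hv fun h h4 => by
        change (ψ h).val.mulVec v = v
        rw [hψ]
        rcases Int.units_eq_one_or (Perm.sign h.val) with h1 | h1
        · rw [h1, map_one, mul_one, hfix h h1 h4]
        · rw [h1, Units.val_mul, val_scal_neg_one, mul_neg_one, Matrix.neg_mulVec,
            hodd h h1 h4, neg_one_smul, neg_neg]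
    refine ⟨B, Or.inr fun s => ?_⟩
    have h1 : ψ s = B * std s * B⁻¹ := hB ⟨s, trivial⟩
    have h2 : φ s = ψ s * scal (Perm.sign s) := by
      rw [hψ, mul_assoc, ← map_mul, Int.units_mul_self, map_one, mul_one]
    rw [h2, h1, mul_assoc, (scal_comm _ B⁻¹).symm.eq]
    simp only [mul_assoc]

/-- The commutant of `sigma` and `tau3` consists of scalars, as comparing matrix entries shows, and
the only scalar involution is `-1`. -/
theorem eq_scal_neg_one_of_commute {z : GL4} (h1 : Commute z (std (finRotate 5)))
    (h2 : Commute z (std threeCycle)) (hz : z * z = 1) (hz1 : z ≠ 1) : z = scal (-1) := by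
  have hσ : z.val * sigma.val = sigma.val * z.val := by
    rw [← std_finRotate]; exact congrArg Units.val h1.eq
  have hτ : z.val * tau3.val = tau3.val * z.val := by
    rw [← std_threeCycle]; exact congrArg Units.val h2.eq
  obtain ⟨c, hc⟩ : ∃ c : ℚ, z.val = c • (1 : Matrix (Fin 4) (Fin 4) ℚ) := by
    refine ⟨z.val 0 0, ?_⟩
    rw [← Matrix.ext_iff] at hσ hτ ⊢
    simp only [sigma, tau3, Matrix.mul_apply, Fin.sum_univ_four, Fin.forall_fin_succ,
      Matrix.smul_apply, Matrix.one_apply] at hσ hτ ⊢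
    simp at hσ hτ ⊢
    casesm* _ ∧ _
    constructorm* _ ∧ _ <;> linarith
  have hc2 : c * c = 1 := by
    have := congrArg (fun w : GL4 => w.val 0 0) hz
    simpa [hc] using this
  rcases mul_self_eq_one_iff.1 hc2 with rfl | rfl
  · exact absurd (Units.ext (by rw [hc, one_smul, Units.val_one])) hz1
  · exact Units.ext (by rw [hc, val_scal_neg_one, neg_one_smul])

/-- Extends a description of `φ` on the first factor to the product: the image of the central
element `(1, -1)`, conjugated back by `B`, commutes with the images of a 5-cycle and a 3-cycle, so
it is `-1`. -/
theorem exists_conj_signedStd {K : Type*} [Group K] {φ : K × ℤˣ →* GL4}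
    (hφ : Function.Injective φ) (j : K →* S5 × ℤˣ) (B : GL4)
    (hB : ∀ s : K, φ (s, 1) = B * signedStd (j s) * B⁻¹) {a b : K} (ha : (j a) = (finRotate 5, 1))
    (hb : (j b) = (threeCycle, 1)) (x : K × ℤˣ) :
    φ x = B * signedStd (j x.1 * (1, x.2)) * B⁻¹ := by
  have hz : B⁻¹ * φ (1, -1) * B = scal (-1) := by
    have hcomm (s : K) : Commute (B⁻¹ * φ (1, -1) * B) (signedStd (j s)) := by
      have h1 : signedStd (j s) = B⁻¹ * φ (s, 1) * B := by rw [hB]; group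
      have h2 : φ (1, -1) * φ (s, 1) = φ (s, 1) * φ (1, -1) := by
        rw [← map_mul, ← map_mul]; simp
      rw [h1, Commute, SemiconjBy]
      calc _ = B⁻¹ * (φ (1, -1) * φ (s, 1)) * B := by group
        _ = _ := by rw [h2]; group
    have ha' := hcomm a
    have hb' := hcomm b
    rw [ha, signedStd_apply, map_one, mul_one] at ha'
    rw [hb, signedStd_apply, map_one, mul_one] at hb'
    refine eq_scal_neg_one_of_commute ha' hb' ?_ fun h => ?_
    · calc _ = B⁻¹ * (φ (1, -1) * φ (1, -1)) * B := by group
        _ = 1 := by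
          rw [← map_mul, Prod.mk_mul_mk, one_mul, Int.units_mul_self, ← Prod.one_eq_mk, map_one]
          group
    · have h1 : φ (1, -1) = 1 := by
        calc φ (1, -1) = B * (B⁻¹ * φ (1, -1) * B) * B⁻¹ := by group
          _ = 1 := by rw [h]; group
      have := congrArg Prod.snd (hφ (h1.trans (map_one φ).symm))
      exact absurd (show (-1 : ℤˣ) = 1 from this) (by decide)
  have hu (u : ℤˣ) : φ (1, u) = B * scal u * B⁻¹ := by
    rcases Int.units_eq_one_or u with rfl | rfl
    · rw [map_one, mul_one, mul_inv_cancel]; exact map_one φ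
    · rw [← hz]; group
  obtain ⟨s, u⟩ := x
  have h1 : φ (s, u) = φ (s, 1) * φ (1, u) := by rw [← map_mul]; simp
  have h2 : signedStd (1, u) = scal u := by rw [signedStd_apply, map_one, one_mul]
  rw [h1, hB, hu, map_mul, h2]
  group

theorem equiv_A5_iff (G : Subgroup GL4) : Nonempty (G ≃* A5) ↔ AreConjugate G G3 := by
  rw [G3_eq]
  refine ⟨fun ⟨e⟩ => ?_, AreConjugate.nonempty_equiv (signedStd_injective.comp altInl_injective)⟩
  obtain ⟨B, hB⟩ := exists_conj_std_of_A5 (φ := G.subtype.comp e.symm.toMonoidHom)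
    (Subtype.val_injective.comp e.symm.injective)
  refine areConjugate_range e.symm id Function.surjective_id B fun x => ?_
  rw [signedStd_altInl]
  exact hB x

theorem equiv_S5_iff (G : Subgroup GL4) :
    Nonempty (G ≃* S5) ↔ AreConjugate G G4 ∨ AreConjugate G G5 := by
  rw [G4_eq, G5_eq]
  refine ⟨fun ⟨e⟩ => ?_, ?_⟩
  · obtain ⟨B, hB | hB⟩ := exists_conj_std_of_S5 (φ := G.subtype.comp e.symm.toMonoidHom)
      (Subtype.val_injective.comp e.symm.injective)
    · refine Or.inl (areConjugate_range e.symm id Function.surjective_id B fun x => ?_)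
      rw [signedStd_inl]
      exact hB x
    · exact Or.inr (areConjugate_range e.symm id Function.surjective_id B hB)
  · rintro (h | h)
    · exact h.nonempty_equiv (signedStd_injective.comp (Prod.mk_left_injective 1))
    · exact h.nonempty_equiv (signedStd_injective.comp signGraph_injective)

theorem equiv_A5_prod_iff (G : Subgroup GL4) : Nonempty (G ≃* A5 × C2) ↔ AreConjugate G G6 := by
  obtain ⟨c⟩ := nonempty_C2_equiv
  rw [G6_eq]
  refine ⟨fun ⟨e⟩ => ?_, fun h => ?_⟩
  · replace e : A5 × ℤˣ ≃* G := ((MulEquiv.refl A5).prodCongr c.symm).trans e.symm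
    have hinj : Function.Injective (G.subtype.comp e.toMonoidHom) :=
      Subtype.val_injective.comp e.injective
    obtain ⟨B, hB⟩ := exists_conj_std_of_A5
      (φ := (G.subtype.comp e.toMonoidHom).comp (MonoidHom.inl A5 ℤˣ))
      (hinj.comp (Prod.mk_left_injective 1))
    refine areConjugate_range e id Function.surjective_id B fun x => ?_
    have := exists_conj_signedStd hinj altInl B
      (fun s => by rw [← MonoidHom.comp_apply, signedStd_altInl]; exact hB s)
      (a := ⟨_, sign_finRotate_five⟩) (b := ⟨_, sign_threeCycle⟩) rfl rfl x
    refine this.trans ?_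
    simp [altInl, altProd_apply]
  · obtain ⟨f⟩ := h.nonempty_equiv (f := signedStd.comp altProd)
      (signedStd_injective.comp altProd_injective)
    exact ⟨f.trans ((MulEquiv.refl A5).prodCongr c.symm)⟩

theorem equiv_S5_prod_iff (G : Subgroup GL4) : Nonempty (G ≃* S5 × C2) ↔ AreConjugate G G7 := by
  obtain ⟨c⟩ := nonempty_C2_equiv
  rw [G7_eq]
  refine ⟨fun ⟨e⟩ => ?_, fun h => ?_⟩
  · replace e : S5 × ℤˣ ≃* G := ((MulEquiv.refl S5).prodCongr c.symm).trans e.symm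
    have hinj : Function.Injective (G.subtype.comp e.toMonoidHom) :=
      Subtype.val_injective.comp e.injective
    -- The standard and the twisted case have the same image once `-1` is present: `(s, u) ↦ j s *
    -- (1, u)` is onto for either choice of `j`.
    have main (j : S5 →* S5 × ℤˣ) (hj : ∀ s, (j s).1 = s)
        (hj1 : ∀ s, Perm.sign s = 1 → (j s).2 = 1) (B : GL4)
        (hB : ∀ s, (e (s, 1) : GL4) = B * signedStd (j s) * B⁻¹) :
        AreConjugate G signedStd.range := by
      refine areConjugate_range e (fun x => j x.1 * (1, x.2)) (fun y => ?_) B fun x => ?_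
      · exact ⟨(y.1, (j y.1).2⁻¹ * y.2), Prod.ext (by simp [hj]) (mul_inv_cancel_left _ _)⟩
      · exact exists_conj_signedStd hinj j B hB (a := finRotate 5) (b := threeCycle)
          (Prod.ext (hj _) (hj1 _ sign_finRotate_five)) (Prod.ext (hj _) (hj1 _ sign_threeCycle)) x
    obtain ⟨B, hB | hB⟩ := exists_conj_std_of_S5
      (φ := (G.subtype.comp e.toMonoidHom).comp (MonoidHom.inl S5 ℤˣ))
      (hinj.comp (Prod.mk_left_injective 1))
    · refine main (MonoidHom.inl S5 ℤˣ) (fun _ => rfl) (fun _ _ => rfl) B fun s => ?_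
      rw [← MonoidHom.comp_apply, signedStd_inl]
      exact hB s
    · exact main signGraph (fun _ => rfl) (fun _ h => h) B hB
  · obtain ⟨f⟩ := h.nonempty_equiv signedStd_injective
    exact ⟨f.trans ((MulEquiv.refl S5).prodCongr c.symm)⟩

end FourDimLinear

namespace FourDimLinear

open IntermediateField

/-! ### Rational generators of fixed fields -/

theorem IsRational.of_algEquiv {k L L' : Type*} [Field k] [Field L] [Field L'] [Algebra k L]
    [Algebra k L'] (e : L ≃ₐ[k] L') (h : IsRational k L) : IsRational k L' := by
  obtain ⟨n, t, ht, ht'⟩ := h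
  refine ⟨n, e ∘ t, ht.map' (f := e.toAlgHom) e.injective, ?_⟩
  have h1 := congrArg (IntermediateField.map e.toAlgHom) ht'
  rw [adjoin_map, ← Set.range_comp, ← AlgHom.fieldRange_eq_map] at h1
  refine h1.trans (AlgHom.fieldRange_eq_top.2 e.surjective)

theorem mem_fixedSubfield_map {G H : Subgroup GL4} {g : GL4}
    (h : G = H.map (MulAut.conj g).toMonoidHom) :
    fixedSubfield G = (fixedSubfield H).map (fieldAction g).toAlgHom := by
  ext f
  rw [mem_fixedSubfield, IntermediateField.mem_map]
  constructor
  · intro hf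
    refine ⟨fieldAction g⁻¹ f, (mem_fixedSubfield _ _).2 fun a ha => ?_, ?_⟩
    · have h1 := hf (g * a * g⁻¹) (h ▸ ⟨a, ha, rfl⟩)
      conv_rhs => rw [← h1]
      simp only [← AlgEquiv.mul_apply, ← map_mul]
      congr 2
      group
    · change fieldAction g (fieldAction g⁻¹ f) = f
      rw [← AlgEquiv.mul_apply, ← map_mul, mul_inv_cancel, map_one, AlgEquiv.one_apply]
  · rintro ⟨f, hf, rfl⟩ a ha
    rw [h] at ha
    obtain ⟨b, hb, rfl⟩ := ha
    have h1 := (mem_fixedSubfield _ _).1 hf b hb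
    change fieldAction (g * b * g⁻¹) (fieldAction g f) = fieldAction g f
    conv_rhs => rw [← h1]
    simp only [← AlgEquiv.mul_apply, ← map_mul]
    congr 2
    group

theorem AreConjugate.isRational {G H : Subgroup GL4} (h : AreConjugate G H)
    (hH : IsRational ℚ (fixedSubfield H)) : IsRational ℚ (fixedSubfield G) := by
  obtain ⟨g, hg⟩ := h
  rw [mem_fixedSubfield_map hg]
  exact hH.of_algEquiv (intermediateFieldMap (fieldAction g) (fixedSubfield H))

theorem four_le_trdeg : (4 : Cardinal) ≤ Algebra.trdeg ℚ RatFun4 := by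
  have h := (MvPolynomial.algebraicIndependent_X (Fin 4) ℚ).map'
    (f := IsScalarTower.toAlgHom ℚ (MvPolynomial (Fin 4) ℚ) RatFun4)
    (IsFractionRing.injective (MvPolynomial (Fin 4) ℚ) RatFun4)
  simpa using h.cardinalMk_le_trdeg

/-- A generating family up to algebraic extension contains a transcendence basis; with no more than
`trdeg` members it is one. Independence of proposed generators of a fixed field therefore needs no
computation. -/
theorem algebraicIndependent_of_isAlgebraic {k L : Type*} [Field k] [Field L] [Algebra k L]
    {n : ℕ} (t : Fin n → L) (htr : (n : Cardinal) ≤ Algebra.trdeg k L)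
    (h : Algebra.IsAlgebraic (adjoin k (Set.range t)) L) : AlgebraicIndependent k t := by
  open scoped IntermediateField.algebraAdjoinAdjoin in
  have : Algebra.IsAlgebraic (Algebra.adjoin k (Set.range t)) L :=
    (IsFractionRing.comap_isAlgebraic_iff (K := adjoin k (Set.range t))).2 h
  exact (Algebra.IsAlgebraic.isTranscendenceBasis_of_lift_le_trdeg_of_finite k t (by simpa using htr)).1

theorem isRational_adjoin {k L : Type*} [Field k] [Field L] [Algebra k L] {n : ℕ} {t : Fin n → L}
    (ht : AlgebraicIndependent k t) : IsRational k (adjoin k (Set.range t)) := by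
  refine ⟨n, fun i => ⟨t i, subset_adjoin _ _ ⟨i, rfl⟩⟩, ?_, ?_⟩
  · exact AlgebraicIndependent.of_comp (adjoin k (Set.range t)).val ht
  · refine lift_injective (adjoin k (Set.range t)) ?_
    rw [lift_adjoin, lift_top, ← Set.range_comp]
    rfl

theorem isAlgebraic_fixedSubfield (G : Subgroup GL4) [Finite G] :
    Algebra.IsAlgebraic (fixedSubfield G) RatFun4 := by
  have : Finite (G.map fieldAction) := Set.Finite.image _ (Set.toFinite (G : Set GL4))
  refine ⟨fun x => ?_⟩
  exact (FixedPoints.isIntegral (G.map fieldAction) RatFun4 x).isAlgebraic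

theorem isRational_of_eq_adjoin {G : Subgroup GL4} [Finite G] {t : Fin 4 → RatFun4}
    (h : fixedSubfield G = adjoin ℚ (Set.range t)) : IsRational ℚ (fixedSubfield G) := by
  have ht : AlgebraicIndependent ℚ t :=
    algebraicIndependent_of_isAlgebraic t (by simpa using four_le_trdeg)
      (h ▸ isAlgebraic_fixedSubfield G)
  rw [h]
  convert isRational_adjoin ht
  exact Subsingleton.elim _ _

/-! ### Linear forms -/

/-- The linear form with coefficient vector `v`. -/
noncomputable def linForm (v : Fin 4 → ℚ) : RatFun4 :=
  ∑ k, algebraMap ℚ RatFun4 (v k) * algebraMap (MvPolynomial (Fin 4) ℚ) RatFun4 (X k)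

theorem fieldAction_linForm (g : GL4) (v : Fin 4 → ℚ) :
    fieldAction g (linForm v) = linForm (g.val.mulVec v) := by
  simp only [linForm, map_sum, map_mul, AlgEquiv.commutes, fieldAction_X, Matrix.mulVec,
    dotProduct, Finset.mul_sum, Finset.sum_mul]
  rw [Finset.sum_comm]
  refine Finset.sum_congr rfl fun i _ => Finset.sum_congr rfl fun j _ => ?_
  ring

theorem linForm_add (v w : Fin 4 → ℚ) : linForm (v + w) = linForm v + linForm w := by
  simp [linForm, add_mul, Finset.sum_add_distrib]

theorem linForm_neg (v : Fin 4 → ℚ) : linForm (-v) = -linForm v := by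
  simp [linForm]

theorem linForm_single (i : Fin 4) :
    linForm (Pi.single i 1) = algebraMap (MvPolynomial (Fin 4) ℚ) RatFun4 (X i) := by
  rw [linForm, Finset.sum_eq_single i]
  · simp
  · intro j _ hj
    simp [Pi.single_eq_of_ne hj]
  · simp

/-- The five linear forms `x_1, …, x_4, x_5 = -(x_1 + x_2 + x_3 + x_4)`. -/
noncomputable def root (i : Fin 5) : RatFun4 := linForm (stdVec i)

theorem root_castSucc (i : Fin 4) :
    root i.castSucc = algebraMap (MvPolynomial (Fin 4) ℚ) RatFun4 (X i) := by
  rw [root, stdVec_castSucc, linForm_single]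

theorem root_last : root 4 = -(root 0 + root 1 + root 2 + root 3) := by
  have h := stdVec_last
  rw [Fin.sum_univ_four] at h
  have h2 := congrArg linForm h
  rw [linForm_neg, linForm_add, linForm_add, linForm_add] at h2
  exact h2

theorem fieldAction_std_root (s : S5) (i : Fin 5) : fieldAction (std s) (root i) = root (s i) := by
  rw [root, fieldAction_linForm, val_std, stdMatrix_mulVec, root]

theorem adjoin_range_root : adjoin ℚ (Set.range root) = ⊤ := by
  rw [eq_top_iff]
  intro f _
  obtain ⟨a, b, -, rfl⟩ := IsFractionRing.div_surjective (A := MvPolynomial (Fin 4) ℚ) f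
  have h (p : MvPolynomial (Fin 4) ℚ) :
      algebraMap (MvPolynomial (Fin 4) ℚ) RatFun4 p ∈ adjoin ℚ (Set.range root) := by
    induction p using MvPolynomial.induction_on with
    | C a =>
      rw [← algebraMap_eq, ← IsScalarTower.algebraMap_apply]
      exact IntermediateField.algebraMap_mem _ a
    | add p q hp hq => rw [map_add]; exact add_mem hp hq
    | mul_X p i hp =>
      rw [map_mul, ← root_castSucc]
      exact mul_mem hp (subset_adjoin _ _ ⟨_, rfl⟩)
  exact div_mem (h a) (h b)

theorem algebraicIndependent_root : AlgebraicIndependent ℚ fun i : Fin 4 => root i.castSucc := by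
  have h := (MvPolynomial.algebraicIndependent_X (Fin 4) ℚ).map'
    (f := IsScalarTower.toAlgHom ℚ (MvPolynomial (Fin 4) ℚ) RatFun4)
    (IsFractionRing.injective (MvPolynomial (Fin 4) ℚ) RatFun4)
  simpa only [root_castSucc] using! h

theorem injective_of_algebraicIndependent {k L : Type*} [Field k] [CharZero k] [Field L]
    [Algebra k L] {x : Fin 5 → L} (h : AlgebraicIndependent k fun i : Fin 4 => x i.castSucc)
    (h4 : x 4 = -(x 0 + x 1 + x 2 + x 3)) : Function.Injective x := by
  have hl := h.linearIndependent
  rw [Fintype.linearIndependent_iff] at hl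
  have h4' (i : Fin 4) : x i.castSucc ≠ x 4 := by
    intro hi
    -- If `x_i = x_5 = -(x_1 + x_2 + x_3 + x_4)`, then `x_i` occurs with coefficient two in a
    -- vanishing sum and the others with coefficient one.
    have h1 := hl (fun j => if j = i then 2 else 1) (by
      rw [h4] at hi
      fin_cases i <;> simp [Fin.sum_univ_four, two_smul] at hi ⊢ <;> linear_combination hi)
    have h2 := h1 i
    simp at h2
  intro i j hij
  induction i using Fin.lastCases with
  | last =>
    induction j using Fin.lastCases with
    | last => rfl
    | cast j => exact absurd hij.symm (h4' j)
  | cast i =>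
    induction j using Fin.lastCases with
    | last => exact absurd hij (h4' i)
    | cast j => rw [h.injective hij]

theorem root_injective : Function.Injective root :=
  injective_of_algebraicIndependent algebraicIndependent_root root_last

theorem eq_on_adjoin {k L K : Type*} [Field k] [Field L] [Field K] [Algebra k L] [Algebra k K]
    {φ ψ : L →ₐ[k] K} {s : Set L} (h : ∀ x ∈ s, φ x = ψ x) {f : L} (hf : f ∈ adjoin k s) :
    φ f = ψ f := by
  have h1 : φ.comp (adjoin k s).val = ψ.comp (adjoin k s).val := adjoin_algHom_ext k h
  exact DFunLike.congr_fun h1 ⟨f, hf⟩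

theorem algEquiv_ext_root {φ ψ : RatFun4 ≃ₐ[ℚ] RatFun4} (h : ∀ i, φ (root i) = ψ (root i))
    (f : RatFun4) : φ f = ψ f :=
  eq_on_adjoin (φ := (φ : RatFun4 →ₐ[ℚ] RatFun4)) (ψ := ψ) (s := Set.range root)
    (by rintro _ ⟨i, rfl⟩; exact h i) (by rw [adjoin_range_root]; trivial)

end FourDimLinear

namespace FourDimLinear

open IntermediateField

/-! ### Elementary symmetric functions of five elements -/

section Symmetric

variable {R : Type*} [CommRing R]

/-- The first elementary symmetric function. -/
def e1 (x : Fin 5 → R) : R := x 0 + x 1 + x 2 + x 3 + x 4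

/-- The second elementary symmetric function. -/
def e2 (x : Fin 5 → R) : R :=
  x 0 * x 1 + x 0 * x 2 + x 0 * x 3 + x 0 * x 4 + x 1 * x 2 + x 1 * x 3 + x 1 * x 4 + x 2 * x 3 +
    x 2 * x 4 + x 3 * x 4

/-- The third elementary symmetric function. -/
def e3 (x : Fin 5 → R) : R :=
  x 0 * x 1 * x 2 + x 0 * x 1 * x 3 + x 0 * x 1 * x 4 + x 0 * x 2 * x 3 + x 0 * x 2 * x 4 +
    x 0 * x 3 * x 4 + x 1 * x 2 * x 3 + x 1 * x 2 * x 4 + x 1 * x 3 * x 4 + x 2 * x 3 * x 4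

/-- The fourth elementary symmetric function. -/
def e4 (x : Fin 5 → R) : R :=
  x 0 * x 1 * x 2 * x 3 + x 0 * x 1 * x 2 * x 4 + x 0 * x 1 * x 3 * x 4 + x 0 * x 2 * x 3 * x 4 +
    x 1 * x 2 * x 3 * x 4

/-- The fifth elementary symmetric function. -/
def e5 (x : Fin 5 → R) : R := x 0 * x 1 * x 2 * x 3 * x 4

/-- The square root of the discriminant. -/
def delta (x : Fin 5 → R) : R := (Matrix.vandermonde x).det

/-- The monic quintic polynomial with prescribed elementary symmetric functions of the roots. -/
noncomputable def quintic (a b c d e : R) : Polynomial R :=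
  Polynomial.X ^ 5 - Polynomial.C a * Polynomial.X ^ 4 + Polynomial.C b * Polynomial.X ^ 3 -
    Polynomial.C c * Polynomial.X ^ 2 + Polynomial.C d * Polynomial.X - Polynomial.C e

theorem prod_X_sub_C_eq_quintic (x : Fin 5 → R) :
    ∏ i, (Polynomial.X - Polynomial.C (x i)) = quintic (e1 x) (e2 x) (e3 x) (e4 x) (e5 x) := by
  simp only [Fin.prod_univ_five, quintic, e1, e2, e3, e4, e5, map_add, map_mul]
  ring

theorem map_quintic {S : Type*} [CommRing S] (f : R →+* S) (a b c d e : R) :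
    (quintic a b c d e).map f = quintic (f a) (f b) (f c) (f d) (f e) := by
  simp [quintic]

theorem quintic_injective {a b c d e a' b' c' d' e' : R}
    (h : quintic a b c d e = quintic a' b' c' d' e') :
    a = a' ∧ b = b' ∧ c = c' ∧ d = d' ∧ e = e' := by
  have h4 := congrArg (Polynomial.coeff · 4) h
  have h3 := congrArg (Polynomial.coeff · 3) h
  have h2 := congrArg (Polynomial.coeff · 2) h
  have h1 := congrArg (Polynomial.coeff · 1) h
  have h0 := congrArg (Polynomial.coeff · 0) h
  simp [quintic, Polynomial.coeff_X, Polynomial.coeff_C] at h4 h3 h2 h1 h0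
  exact ⟨h4, h3, h2, h1, h0⟩

theorem esymm_comp_perm (x : Fin 5 → R) (s : Equiv.Perm (Fin 5)) :
    e1 (x ∘ s) = e1 x ∧ e2 (x ∘ s) = e2 x ∧ e3 (x ∘ s) = e3 x ∧ e4 (x ∘ s) = e4 x ∧
      e5 (x ∘ s) = e5 x := by
  apply quintic_injective
  rw [← prod_X_sub_C_eq_quintic, ← prod_X_sub_C_eq_quintic]
  exact Equiv.prod_comp s fun i => Polynomial.X - Polynomial.C (x i)

theorem delta_comp_perm (x : Fin 5 → R) (s : Equiv.Perm (Fin 5)) :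
    delta (x ∘ s) = (Equiv.Perm.sign s : ℤ) * delta x :=
  Matrix.det_permute s (Matrix.vandermonde x)

theorem delta_neg (x : Fin 5 → R) : delta (-x) = delta x := by
  simp only [delta, Matrix.det_vandermonde, Fin.prod_univ_succ, Fin.prod_Ioi_succ,
    Fin.prod_Ioi_zero]
  simp
  ring

theorem map_delta {S : Type*} [CommRing S] (f : R →+* S) (x : Fin 5 → R) :
    f (delta x) = delta (f ∘ x) := by
  rw [delta, RingHom.map_det]
  congr 1
  ext i j
  simp [Matrix.vandermonde_apply]

/-- The discriminant of `X^5 + a X^3 - b X^2 + c X - d`. -/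
def disc5 (a b c d : R) : R :=
  108 * a ^ 5 * d ^ 2 - 72 * a ^ 4 * b * c * d + 16 * a ^ 4 * c ^ 3 + 16 * a ^ 3 * b ^ 3 * d -
    4 * a ^ 3 * b ^ 2 * c ^ 2 - 900 * a ^ 3 * c * d ^ 2 + 825 * a ^ 2 * b ^ 2 * d ^ 2 +
    560 * a ^ 2 * b * c ^ 2 * d - 128 * a ^ 2 * c ^ 4 - 630 * a * b ^ 3 * c * d +
    144 * a * b ^ 2 * c ^ 3 - 3750 * a * b * d ^ 3 + 2000 * a * c ^ 2 * d ^ 2 + 108 * b ^ 5 * d -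
    27 * b ^ 4 * c ^ 2 + 2250 * b ^ 2 * c * d ^ 2 - 1600 * b * c ^ 3 * d + 256 * c ^ 5 +
    3125 * d ^ 4

theorem sum_pow_add_five (x : Fin 5 → R) (h : e1 x = 0) (n : ℕ) :
    ∑ i, x i ^ (n + 5) = -e2 x * ∑ i, x i ^ (n + 3) + e3 x * ∑ i, x i ^ (n + 2) -
      e4 x * ∑ i, x i ^ (n + 1) + e5 x * ∑ i, x i ^ n := by
  have hr (i : Fin 5) : x i ^ 5 + e2 x * x i ^ 3 - e3 x * x i ^ 2 + e4 x * x i - e5 x = 0 := by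
    have h1 := congrArg (Polynomial.eval (x i)) (prod_X_sub_C_eq_quintic x)
    rw [Polynomial.eval_prod, Finset.prod_eq_zero (Finset.mem_univ i) (by simp), h] at h1
    simp [quintic] at h1
    linear_combination -h1
  simp only [Finset.mul_sum, ← Finset.sum_add_distrib, ← Finset.sum_sub_distrib]
  refine Finset.sum_congr rfl fun i _ => ?_
  linear_combination x i ^ n * hr i

theorem det_fin_four (A : Matrix (Fin 4) (Fin 4) R) :
    A.det =
    A 0 0 * (A 1 1 * A 2 2 * A 3 3 - A 1 1 * A 2 3 * A 3 2 - A 1 2 * A 2 1 * A 3 3 +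
        A 1 2 * A 2 3 * A 3 1 + A 1 3 * A 2 1 * A 3 2 - A 1 3 * A 2 2 * A 3 1)
    - A 0 1 * (A 1 0 * A 2 2 * A 3 3 - A 1 0 * A 2 3 * A 3 2 - A 1 2 * A 2 0 * A 3 3 +
        A 1 2 * A 2 3 * A 3 0 + A 1 3 * A 2 0 * A 3 2 - A 1 3 * A 2 2 * A 3 0)
    + A 0 2 * (A 1 0 * A 2 1 * A 3 3 - A 1 0 * A 2 3 * A 3 1 - A 1 1 * A 2 0 * A 3 3 +
        A 1 1 * A 2 3 * A 3 0 + A 1 3 * A 2 0 * A 3 1 - A 1 3 * A 2 1 * A 3 0)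
    - A 0 3 * (A 1 0 * A 2 1 * A 3 2 - A 1 0 * A 2 2 * A 3 1 - A 1 1 * A 2 0 * A 3 2 +
        A 1 1 * A 2 2 * A 3 0 + A 1 2 * A 2 0 * A 3 1 - A 1 2 * A 2 1 * A 3 0) := by
  rw [Matrix.det_succ_row_zero, Fin.sum_univ_four]
  simp only [Matrix.det_fin_three, Matrix.submatrix_apply]
  simp [Fin.succAbove, Fin.lt_def]
  ring

/-- For the Vandermonde matrix `V`, `VᵀV` is the Hankel matrix of power sums, and Newton's
identities express the power sums up to the eighth through `e2, …, e5`. -/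
theorem delta_sq (x : Fin 5 → R) (h : e1 x = 0) :
    delta x ^ 2 = disc5 (e2 x) (e3 x) (e4 x) (e5 x) := by
  have h4 : x 4 = -(x 0 + x 1 + x 2 + x 3) := by
    rw [e1] at h
    linear_combination h
  have p0 : ∑ i, x i ^ 0 = 5 := by simp
  have p1 : ∑ i, x i ^ 1 = 0 := by rw [Fin.sum_univ_five, h4]; ring
  have p2 : ∑ i, x i ^ 2 = -2 * e2 x := by rw [Fin.sum_univ_five, e2, h4]; ring
  have p3 : ∑ i, x i ^ 3 = 3 * e3 x := by rw [Fin.sum_univ_five, e3, h4]; ring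
  have p4 : ∑ i, x i ^ 4 = 2 * e2 x ^ 2 - 4 * e4 x := by
    rw [Fin.sum_univ_five, e2, e4, h4]; ring
  have p5 := sum_pow_add_five x h 0
  have p6 := sum_pow_add_five x h 1
  have p7 := sum_pow_add_five x h 2
  have p8 := sum_pow_add_five x h 3
  norm_num only at p5 p6 p7 p8
  rw [p3, p2, p1, p0] at p5
  rw [p4, p3, p2, p1] at p6
  rw [p5, p4, p3, p2] at p7
  rw [p6, p5, p4, p3] at p8
  obtain ⟨q, hq⟩ : ∃ q : ℕ → R, ∀ n, ∑ i, x i ^ n = q n := ⟨_, fun _ => rfl⟩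
  have hM : (Matrix.vandermonde x).transpose * Matrix.vandermonde x =
      Matrix.of fun i j : Fin 5 => q ((i : ℕ) + (j : ℕ)) := by
    ext i j
    simp [Matrix.mul_apply, Matrix.vandermonde_apply, pow_add, ← hq]
  have hd := congrArg Matrix.det hM
  rw [Matrix.det_mul, Matrix.det_transpose, ← pow_two] at hd
  rw [delta, hd]
  rw [hq] at p0 p1 p2 p3 p4 p5 p6 p7 p8
  rw [Matrix.det_succ_row_zero, Fin.sum_univ_five]
  simp only [det_fin_four, Matrix.submatrix_apply, Matrix.of_apply]
  simp [Fin.succAbove, Fin.lt_def, p0, p1]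
  simp only [p2, p3, p4, p5, p6, p7, p8, disc5]
  ring

end Symmetric

/-! ### The field of symmetric functions -/

/-- `L` is the splitting field over `K` of the separable quintic with roots `x i`, hence Galois, and
every automorphism over `K` permutes these roots. -/
theorem mem_of_fixed_by_perm {k L : Type*} [Field k] [CharZero k] [Field L] [Algebra k L]
    {x : Fin 5 → L} (hinj : Function.Injective x) (htop : adjoin k (Set.range x) = ⊤)
    {K : IntermediateField k L} (h1 : e1 x ∈ K) (h2 : e2 x ∈ K) (h3 : e3 x ∈ K) (h4 : e4 x ∈ K)
    (h5 : e5 x ∈ K) {f : L}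
    (hf : ∀ φ : L ≃ₐ[k] L, (∃ s : Equiv.Perm (Fin 5), ∀ i, φ (x i) = x (s i)) → φ f = f) :
    f ∈ K := by
  let p : Polynomial K := quintic ⟨_, h1⟩ ⟨_, h2⟩ ⟨_, h3⟩ ⟨_, h4⟩ ⟨_, h5⟩
  have hp : p.map (algebraMap K L) = ∏ i, (Polynomial.X - Polynomial.C (x i)) := by
    rw [prod_X_sub_C_eq_quintic, map_quintic]
    rfl
  have hp0 : p.map (algebraMap K L) ≠ 0 := by
    rw [hp]
    exact (Polynomial.monic_prod_of_monic _ _ fun i _ => Polynomial.monic_X_sub_C _).ne_zero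
  have hroot (y : L) : y ∈ p.rootSet L ↔ ∃ i, y = x i := by
    rw [Polynomial.mem_rootSet', ← Polynomial.eval_map_algebraMap, hp, Polynomial.eval_prod,
      Finset.prod_eq_zero_iff]
    simp [← hp, hp0, sub_eq_zero]
  have hrange : p.rootSet L = Set.range x := by
    ext y
    rw [hroot]
    exact ⟨fun ⟨i, hi⟩ => ⟨i, hi.symm⟩, fun ⟨i, hi⟩ => ⟨i, hi.symm⟩⟩
  have hsplit : p.IsSplittingField K L := by
    rw [isSplittingField_iff_intermediateField]
    refine ⟨?_, ?_⟩
    · rw [hp]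
      exact Polynomial.Splits.prod fun i _ => Polynomial.Splits.X_sub_C _
    · rw [hrange, ← restrictScalars_eq_top_iff (K := k), restrictScalars_adjoin, eq_top_iff, ← htop]
      exact adjoin.mono _ _ _ Set.subset_union_right
  have hsep : p.Separable := by
    rw [← Polynomial.separable_map (algebraMap K L), hp, Polynomial.separable_prod_X_sub_C_iff]
    exact hinj
  have := IsGalois.of_separable_splitting_field (E := L) hsep
  have := Polynomial.IsSplittingField.finiteDimensional L p
  have hmem := (IsGalois.mem_range_algebraMap_iff_fixed (F := K) f).2 fun φ => by
    refine hf (φ.restrictScalars k) ?_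
    have hφ (i : Fin 5) : ∃ j, φ (x i) = x j := by
      have h1 : Polynomial.aeval (φ (x i)) p = 0 := by
        have h2 : x i ∈ p.rootSet L := (hroot _).2 ⟨i, rfl⟩
        have h3 := Polynomial.aeval_algHom_apply (φ : L →ₐ[K] L) (x i) p
        rw [(Polynomial.mem_rootSet'.1 h2).2, map_zero] at h3
        exact h3
      exact (hroot _).1 (Polynomial.mem_rootSet'.2 ⟨hp0, h1⟩)
    choose s hs using hφ
    have hsinj : Function.Injective s := fun i j hij =>
      hinj (φ.injective (by rw [hs, hs, hij]))
    exact ⟨Equiv.ofBijective s (Finite.injective_iff_bijective.1 hsinj), hs⟩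
  obtain ⟨y, rfl⟩ := hmem
  exact y.2

end FourDimLinear

namespace FourDimLinear

open IntermediateField Equiv

/-! ### Descent along a sign change -/

/-- `E + E y` is closed under the field operations. For inverses one multiplies by the conjugate `a
- b y`, which is nonzero because it is the image of `a + b y` under the injective `φ`. -/
theorem exists_add_mul_of_mem_adjoin {k L : Type*} [Field k] [Field L] [Algebra k L]
    {E : IntermediateField k L} {y : L} (hy : y ^ 2 ∈ E) {φ : L →ₐ[k] L}
    (hE : ∀ z ∈ E, φ z = z) (hφ : φ y = -y) {S : Set L}
    (hS : ∀ s ∈ S, ∃ a ∈ E, ∃ b ∈ E, s = a + b * y) {f : L} (hf : f ∈ adjoin k S) :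
    ∃ a ∈ E, ∃ b ∈ E, f = a + b * y := by
  induction hf using IntermediateField.adjoin_induction with
  | mem s hs => exact hS s hs
  | algebraMap c => exact ⟨_, E.algebraMap_mem c, 0, E.zero_mem, by simp⟩
  | add f g _ _ hf hg =>
    obtain ⟨a, ha, b, hb, rfl⟩ := hf
    obtain ⟨c, hc, d, hd, rfl⟩ := hg
    exact ⟨_, add_mem ha hc, _, add_mem hb hd, by ring⟩
  | inv f _ hf =>
    obtain ⟨a, ha, b, hb, rfl⟩ := hf
    by_cases h0 : a + b * y = 0
    · exact ⟨0, E.zero_mem, 0, E.zero_mem, by simp [h0]⟩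
    have h1 : a - b * y ≠ 0 := by
      have h2 := (map_ne_zero φ).2 h0
      rwa [map_add, map_mul, hE a ha, hE b hb, hφ, mul_neg, ← sub_eq_add_neg] at h2
    have hn : a ^ 2 - b ^ 2 * y ^ 2 ∈ E := sub_mem (pow_mem ha 2) (mul_mem (pow_mem hb 2) hy)
    have hn0 : a ^ 2 - b ^ 2 * y ^ 2 ≠ 0 := by
      convert! mul_ne_zero h0 h1 using 1
      ring
    refine ⟨_, div_mem ha hn, _, div_mem (neg_mem hb) hn, ?_⟩
    field_simp
    ring
  | mul f g _ _ hf hg =>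
    obtain ⟨a, ha, b, hb, rfl⟩ := hf
    obtain ⟨c, hc, d, hd, rfl⟩ := hg
    exact ⟨_, add_mem (mul_mem ha hc) (mul_mem (mul_mem hb hd) hy), _,
      add_mem (mul_mem ha hd) (mul_mem hb hc), by ring⟩

theorem mem_of_mem_adjoin_of_fixed {k L : Type*} [Field k] [Field L] [CharZero L] [Algebra k L]
    {E : IntermediateField k L} {y : L} (hy : y ^ 2 ∈ E) {φ : L →ₐ[k] L}
    (hE : ∀ z ∈ E, φ z = z) (hφ : φ y = -y) {S : Set L}
    (hS : ∀ s ∈ S, ∃ a ∈ E, ∃ b ∈ E, s = a + b * y) {f : L} (hf : f ∈ adjoin k S)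
    (hφf : φ f = f) : f ∈ E := by
  obtain ⟨a, ha, b, hb, rfl⟩ := exists_add_mul_of_mem_adjoin hy hE hφ hS hf
  rw [map_add, map_mul, hE a ha, hE b hb, hφ] at hφf
  have h1 : 2 * (b * y) = 0 := by linear_combination -hφf
  have h2 : b * y = 0 := (mul_eq_zero.1 h1).resolve_left two_ne_zero
  rwa [h2, add_zero]

/-! ### The action on symmetric functions -/

theorem fieldAction_signedStd_root (s : S5) (u : ℤˣ) (i : Fin 5) :
    fieldAction (signedStd (s, u)) (root i) = ((u : ℤ) : RatFun4) * root (s i) := by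
  rw [root, fieldAction_linForm, signedStd_mulVec, root]
  rcases Int.units_eq_one_or u with rfl | rfl
  · simp
  · simp [linForm_neg]

theorem map_esymm {R S : Type*} [CommRing R] [CommRing S] (f : R →+* S) (x : Fin 5 → R) :
    f (e2 x) = e2 (f ∘ x) ∧ f (e3 x) = e3 (f ∘ x) ∧ f (e4 x) = e4 (f ∘ x) ∧
      f (e5 x) = e5 (f ∘ x) := by
  simp [e2, e3, e4, e5]

theorem esymm_neg {R : Type*} [CommRing R] (x : Fin 5 → R) :
    e2 (-x) = e2 x ∧ e3 (-x) = -e3 x ∧ e4 (-x) = e4 x ∧ e5 (-x) = -e5 x := by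
  simp only [e2, e3, e4, e5, Pi.neg_apply]
  refine ⟨?_, ?_, ?_, ?_⟩ <;> ring

theorem fieldAction_signedStd_esymm (s : S5) (u : ℤˣ) :
    fieldAction (signedStd (s, u)) (e2 root) = e2 root ∧
    fieldAction (signedStd (s, u)) (e3 root) = ((u : ℤ) : RatFun4) * e3 root ∧
    fieldAction (signedStd (s, u)) (e4 root) = e4 root ∧
    fieldAction (signedStd (s, u)) (e5 root) = ((u : ℤ) : RatFun4) * e5 root ∧
    fieldAction (signedStd (s, u)) (delta root) =
      ((Perm.sign s : ℤ) : RatFun4) * delta root := by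
  set φ : RatFun4 →+* RatFun4 := (fieldAction (signedStd (s, u)) : RatFun4 →+* RatFun4) with hφ
  have hm := map_esymm φ root
  have hd := map_delta φ root
  obtain ⟨-, h2, h3, h4, h5⟩ := esymm_comp_perm root s
  have hs := delta_comp_perm root s
  obtain ⟨n2, n3, n4, n5⟩ := esymm_neg (root ∘ s)
  have hn := delta_neg (root ∘ s)
  rcases Int.units_eq_one_or u with rfl | rfl
  · have hc : φ ∘ root = root ∘ s := funext fun i =>
      (fieldAction_signedStd_root s 1 i).trans (by simp)
    rw [hc, h2, h3, h4, h5] at hm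
    rw [hc, hs] at hd
    simpa using ⟨hm.1, hm.2.1, hm.2.2.1, hm.2.2.2, hd⟩
  · have hc : φ ∘ root = -(root ∘ s) := funext fun i =>
      (fieldAction_signedStd_root s (-1) i).trans (by simp)
    rw [hc, n2, n3, n4, n5, h2, h3, h4, h5] at hm
    rw [hc, hn, hs] at hd
    simpa using ⟨hm.1, hm.2.1, hm.2.2.1, hm.2.2.2, hd⟩

theorem e1_root : e1 root = 0 := by
  rw [e1, root_last]
  ring

theorem std_eq_signedStd (s : S5) : std s = signedStd (s, 1) := by
  rw [signedStd_apply, map_one, mul_one]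

/-! ### Fixed fields of `G4` and `G3` in terms of symmetric functions and the root of the
discriminant. -/

theorem mem_G4 (s : S5) : std s ∈ G4 := by
  rw [G4_eq, signedStd_inl]
  exact ⟨s, rfl⟩

theorem mem_G3 {s : S5} (hs : Perm.sign s = 1) : std s ∈ G3 := by
  rw [G3_eq, signedStd_altInl]
  exact ⟨⟨s, hs⟩, rfl⟩

theorem fixedSubfield_anti {G H : Subgroup GL4} (h : G ≤ H) : fixedSubfield H ≤ fixedSubfield G :=
  fun _ hf => (mem_fixedSubfield _ _).2 fun g hg => (mem_fixedSubfield _ _).1 hf g (h hg)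

theorem mem_fixedSubfield_G4 {K : IntermediateField ℚ RatFun4} (h2 : e2 root ∈ K)
    (h3 : e3 root ∈ K) (h4 : e4 root ∈ K) (h5 : e5 root ∈ K) {f : RatFun4}
    (hf : ∀ s, fieldAction (std s) f = f) : f ∈ K := by
  refine mem_of_fixed_by_perm root_injective adjoin_range_root (by rw [e1_root]; exact K.zero_mem)
    h2 h3 h4 h5 ?_
  rintro φ ⟨s, hs⟩
  refine (algEquiv_ext_root (ψ := fieldAction (std s)) (fun i => ?_) f).trans (hf s)
  rw [hs, fieldAction_std_root]

theorem fixedSubfield_G4 :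
    fixedSubfield G4 = adjoin ℚ (Set.range ![e2 root, e3 root, e4 root, e5 root]) := by
  have hmem (i : Fin 4) : ![e2 root, e3 root, e4 root, e5 root] i ∈
      adjoin ℚ (Set.range ![e2 root, e3 root, e4 root, e5 root]) := subset_adjoin _ _ ⟨i, rfl⟩
  refine le_antisymm (fun f hf => ?_) (adjoin_le_iff.2 ?_)
  · rw [mem_fixedSubfield] at hf
    exact mem_fixedSubfield_G4 (hmem 0) (hmem 1) (hmem 2) (hmem 3) fun s => hf _ (mem_G4 s)
  · rintro _ ⟨i, rfl⟩
    refine (mem_fixedSubfield _ _).2 fun g hg => ?_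
    rw [G4_eq] at hg
    obtain ⟨s, rfl⟩ := hg
    obtain ⟨h2, h3, h4, h5, -⟩ := fieldAction_signedStd_esymm s 1
    simp only [Units.val_one, Int.cast_one, one_mul] at h2 h3 h4 h5
    fin_cases i <;> assumption

theorem finite_range {K : Type*} [Group K] [Finite K] (f : K →* GL4) : Finite f.range :=
  Finite.of_surjective _ f.rangeRestrict_surjective

theorem finite_G4 : Finite G4 := by
  rw [G4_eq]
  exact finite_range _

theorem isRational_G4 : IsRational ℚ (fixedSubfield G4) :=
  have := finite_G4
  isRational_of_eq_adjoin fixedSubfield_G4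

theorem algebraicIndependent_esymm :
    AlgebraicIndependent ℚ ![e2 root, e3 root, e4 root, e5 root] := by
  have := finite_G4
  exact algebraicIndependent_of_isAlgebraic _ (by simpa using four_le_trdeg)
    (fixedSubfield_G4 ▸ isAlgebraic_fixedSubfield G4)

theorem delta_root_ne_zero : delta root ≠ 0 :=
  Matrix.det_vandermonde_ne_zero_iff.2 root_injective

/-- With `τ` a transposition, an `A_5`-invariant `f` splits into the symmetric part `f + τ f` and
the alternating part `f - τ f`; the latter becomes symmetric on division by `Δ`. -/
theorem fixedSubfield_G3 :
    fixedSubfield G3 = adjoin ℚ {e2 root, e3 root, e4 root, e5 root, delta root} := by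
  set S : Set RatFun4 := {e2 root, e3 root, e4 root, e5 root, delta root} with hS
  have m2 : e2 root ∈ adjoin ℚ S := subset_adjoin _ _ (by simp [hS])
  have m3 : e3 root ∈ adjoin ℚ S := subset_adjoin _ _ (by simp [hS])
  have m4 : e4 root ∈ adjoin ℚ S := subset_adjoin _ _ (by simp [hS])
  have m5 : e5 root ∈ adjoin ℚ S := subset_adjoin _ _ (by simp [hS])
  have mΔ : delta root ∈ adjoin ℚ S := subset_adjoin _ _ (by simp [hS])
  refine le_antisymm (fun f hf => ?_) (adjoin_le_iff.2 ?_)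
  · rw [mem_fixedSubfield] at hf
    set τ := fieldAction (std (swap 0 1)) with hτ
    have hτs : Perm.sign (swap (0 : Fin 5) 1) = -1 := Perm.sign_swap (by decide)
    have heven (s : S5) (hs : Perm.sign s = 1) : fieldAction (std s) f = f := hf _ (mem_G3 hs)
    have hmul (s t : S5) (g : RatFun4) :
        fieldAction (std s) (fieldAction (std t) g) = fieldAction (std (s * t)) g := by
      rw [map_mul, map_mul, AlgEquiv.mul_apply]
    have hodd (s : S5) (hs : Perm.sign s = -1) : fieldAction (std s) f = τ f := by
      have h1 : s = swap 0 1 * (swap 0 1 * s) := by rw [← mul_assoc, swap_mul_self, one_mul]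
      rw [h1, ← hmul, heven _ (by rw [Perm.sign_mul, hτs, hs]; rfl)]
    have h1 : f + τ f ∈ adjoin ℚ S := mem_fixedSubfield_G4 m2 m3 m4 m5 fun s => by
      rw [map_add, hτ, hmul, ← hτ]
      rcases Int.units_eq_one_or (Perm.sign s) with hs | hs
      · rw [heven s hs, hodd (s * _) (by rw [Perm.sign_mul, hτs, hs]; rfl)]
      · rw [hodd s hs, heven (s * _) (by rw [Perm.sign_mul, hτs, hs]; rfl), add_comm]
    have h2 : (f - τ f) / delta root ∈ adjoin ℚ S := mem_fixedSubfield_G4 m2 m3 m4 m5 fun s => by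
      have hΔ := (fieldAction_signedStd_esymm s 1).2.2.2.2
      rw [← std_eq_signedStd] at hΔ
      rw [map_div₀, map_sub, hΔ, hτ, hmul, ← hτ]
      rcases Int.units_eq_one_or (Perm.sign s) with hs | hs
      · rw [heven s hs, hodd (s * _) (by rw [Perm.sign_mul, hτs, hs]; rfl), hs]
        simp
      · rw [hodd s hs, heven (s * _) (by rw [Perm.sign_mul, hτs, hs]; rfl), hs]
        simp only [Units.val_neg, Units.val_one, Int.cast_neg, Int.cast_one, neg_one_mul, div_neg,
          ← neg_div, neg_sub]
    have h3 : f = ((f + τ f) + (f - τ f) / delta root * delta root) / 2 := by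
      rw [div_mul_cancel₀ _ delta_root_ne_zero]
      ring
    rw [h3]
    exact div_mem (add_mem h1 (mul_mem h2 mΔ)) (ofNat_mem _ 2)
  · rintro x hx
    refine (mem_fixedSubfield _ _).2 fun g hg => ?_
    rw [G3_eq] at hg
    obtain ⟨s, rfl⟩ := hg
    obtain ⟨h2, h3, h4, h5, hΔ⟩ := fieldAction_signedStd_esymm s 1
    have hs : Perm.sign s.val = 1 := s.2
    simp only [hs, Units.val_one, Int.cast_one, one_mul] at h2 h3 h4 h5 hΔ
    rcases hx with rfl | rfl | rfl | rfl | rfl <;> assumption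

end FourDimLinear

/-! ### Fixed fields of `G7` and `G5`. -/

namespace FourDimLinear

open IntermediateField Equiv

theorem e2_root_ne_zero : e2 root ≠ 0 := algebraicIndependent_esymm.ne_zero 0

theorem e3_root_ne_zero : e3 root ≠ 0 := algebraicIndependent_esymm.ne_zero 1

/-- A fixed field is generated by `t` if the generators are invariant and, over them, a larger
fixed field is obtained by adjoining an element on which the group acts by a sign. -/
theorem fixedSubfield_eq_adjoin {G H : Subgroup GL4} (hHG : H ≤ G) {S : Set RatFun4}
    (hH : fixedSubfield H ≤ adjoin ℚ S) {n : ℕ} {t : Fin n → RatFun4}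
    (ht : ∀ i, ∀ g ∈ G, fieldAction g (t i) = t i) {y : RatFun4}
    (hy : y ^ 2 ∈ adjoin ℚ (Set.range t)) {g : GL4} (hg : g ∈ G) (hgy : fieldAction g y = -y)
    (hS : ∀ s ∈ S, ∃ a ∈ adjoin ℚ (Set.range t), ∃ b ∈ adjoin ℚ (Set.range t), s = a + b * y) :
    fixedSubfield G = adjoin ℚ (Set.range t) := by
  have hle : adjoin ℚ (Set.range t) ≤ fixedSubfield G := by
    rw [adjoin_le_iff]
    rintro _ ⟨i, rfl⟩
    exact (mem_fixedSubfield _ _).2 (ht i)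
  refine le_antisymm (fun f hf => ?_) hle
  exact mem_of_mem_adjoin_of_fixed (φ := (fieldAction g : RatFun4 →ₐ[ℚ] RatFun4)) hy
    (fun z hz => (mem_fixedSubfield _ _).1 (hle hz) g hg) hgy hS
    (hH (fixedSubfield_anti hHG hf)) ((mem_fixedSubfield _ _).1 hf g hg)

theorem lam_eq_signedStd : lam = signedStd (1, -1) := by
  rw [signedStd_apply, map_one, one_mul, scal_neg_one]

theorem tau2_eq_signedStd : tau2 = signedStd (swap 0 1, -1) := by
  rw [signedStd_apply, tau2_eq, std_swap]

theorem signedStd_mem_G7 (x : S5 × ℤˣ) : signedStd x ∈ G7 := by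
  rw [G7_eq]
  exact ⟨x, rfl⟩

theorem units_cast_sq (u : ℤˣ) : ((u : ℤ) : RatFun4) * ((u : ℤ) : RatFun4) = 1 := by
  rw [← Int.cast_mul, ← Units.val_mul, Int.units_mul_self, Units.val_one, Int.cast_one]

theorem units_cast_ne_zero (u : ℤˣ) : ((u : ℤ) : RatFun4) ≠ 0 :=
  left_ne_zero_of_mul_eq_one (units_cast_sq u)

/-- Descent from `G4` along `e3`, which `-1` negates: the other odd generator `e5` is the invariant
`e5 / e3` times `e3`. -/
theorem fixedSubfield_G7 : fixedSubfield G7 =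
    adjoin ℚ (Set.range ![e2 root, e4 root, e3 root ^ 2, e5 root / e3 root]) := by
  set E := adjoin ℚ (Set.range ![e2 root, e4 root, e3 root ^ 2, e5 root / e3 root]) with hE
  have hm (i : Fin 4) : ![e2 root, e4 root, e3 root ^ 2, e5 root / e3 root] i ∈ E :=
    subset_adjoin _ _ ⟨i, rfl⟩
  have h30 := e3_root_ne_zero
  refine fixedSubfield_eq_adjoin (H := G4) ?_ fixedSubfield_G4.le ?_ (y := e3 root) (hm 2)
    (g := lam) ?_ ?_ ?_
  · rw [G4_eq]
    rintro _ ⟨s, rfl⟩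
    exact signedStd_mem_G7 _
  · intro i g hg
    rw [G7_eq] at hg
    obtain ⟨⟨s, u⟩, rfl⟩ := hg
    obtain ⟨h2, h3, h4, h5, -⟩ := fieldAction_signedStd_esymm s u
    have hu := units_cast_sq u
    have hu0 := units_cast_ne_zero u
    fin_cases i
    · exact h2
    · exact h4
    · change fieldAction _ (e3 root ^ 2) = e3 root ^ 2
      rw [map_pow, h3]
      linear_combination e3 root ^ 2 * hu
    · change fieldAction _ (e5 root / e3 root) = e5 root / e3 root
      rw [map_div₀, h3, h5, mul_div_mul_left _ _ hu0]
  · rw [lam_eq_signedStd]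
    exact signedStd_mem_G7 _
  · rw [lam_eq_signedStd, (fieldAction_signedStd_esymm 1 (-1)).2.1]
    simp
  · rintro _ ⟨i, rfl⟩
    fin_cases i
    · exact ⟨_, hm 0, 0, zero_mem _, by simp⟩
    · exact ⟨0, zero_mem _, 1, one_mem _, by simp⟩
    · exact ⟨_, hm 1, 0, zero_mem _, by simp⟩
    · exact ⟨0, zero_mem _, _, hm 3, by simp [h30]⟩

theorem disc5_root_ne_zero : disc5 (e2 root) (e3 root) (e4 root) (e5 root) ≠ 0 := by
  rw [← delta_sq root e1_root]
  exact pow_ne_zero 2 delta_root_ne_zero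

/-- The discriminant as a function of weight zero. -/
def discRatio {R : Type*} [CommRing R] (a b c : R) : R :=
  108 * c ^ 2 * b - 72 * a * c * b + 16 * a ^ 3 + 16 * c * b ^ 2 - 4 * a ^ 2 * b -
    900 * a * c ^ 2 * b + 825 * c ^ 2 * b ^ 2 + 560 * a ^ 2 * c * b - 128 * a ^ 4 -
    630 * a * c * b ^ 2 + 144 * a ^ 3 * b - 3750 * c ^ 3 * b ^ 2 + 2000 * a ^ 2 * c ^ 2 * b +
    108 * c * b ^ 3 - 27 * a ^ 2 * b ^ 2 + 2250 * a * c ^ 2 * b ^ 2 - 1600 * a ^ 3 * c * b +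
    256 * a ^ 5 + 3125 * c ^ 4 * b ^ 2

/-- The discriminant is homogeneous of weight 20 when `x, y, z, w` have weights 2, 3, 4, 5, so
division by `x^10` leaves a function of weight zero. -/
theorem disc5_eq_discRatio {L : Type*} [Field L] {x y z w : L} (hx : x ≠ 0) (hy : y ≠ 0) :
    disc5 x y z w = x ^ 10 * discRatio (z / x ^ 2) (y ^ 2 / x ^ 3) (w / (x * y)) := by
  obtain ⟨a, rfl⟩ : ∃ a, z = a * x ^ 2 := ⟨z / x ^ 2, by field_simp⟩
  obtain ⟨c, rfl⟩ : ∃ c, w = c * (x * y) := ⟨w / (x * y), by field_simp⟩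
  rw [mul_div_cancel_right₀ _ (pow_ne_zero 2 hx), mul_div_cancel_right₀ _ (mul_ne_zero hx hy)]
  rw [discRatio, disc5]
  field_simp

theorem discRatio_mem {k L : Type*} [Field k] [Field L] [Algebra k L] {E : IntermediateField k L}
    {a b c : L} (ha : a ∈ E) (hb : b ∈ E) (hc : c ∈ E) : discRatio a b c ∈ E :=
  (discRatio (⟨a, ha⟩ : E) ⟨b, hb⟩ ⟨c, hc⟩).2

/-- In `G5` odd permutations negate both `e3` and `Δ`, so `e3 Δ` is invariant. Once `e2` is
recovered, the rest is descent from `G3` along `e3`. -/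
theorem fixedSubfield_G5 : fixedSubfield G5 =
    adjoin ℚ (Set.range ![e4 root / e2 root ^ 2, e3 root ^ 2 / e2 root ^ 3,
      e5 root / (e2 root * e3 root), e3 root * delta root / e2 root ^ 6]) := by
  set t := ![e4 root / e2 root ^ 2, e3 root ^ 2 / e2 root ^ 3,
      e5 root / (e2 root * e3 root), e3 root * delta root / e2 root ^ 6] with ht
  have hm (i : Fin 4) : t i ∈ adjoin ℚ (Set.range t) := subset_adjoin _ _ ⟨i, rfl⟩
  have h20 := e2_root_ne_zero
  have h30 := e3_root_ne_zero
  have hΔ0 := delta_root_ne_zero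
  have hdisc := disc5_eq_discRatio (z := e4 root) (w := e5 root) h20 h30
  have hd0 := disc5_root_ne_zero
  rw [hdisc] at hd0
  rw [← delta_sq root e1_root] at hdisc
  have hD : discRatio (t 0) (t 1) (t 2) ∈ adjoin ℚ (Set.range t) :=
    discRatio_mem (hm 0) (hm 1) (hm 2)
  have hD0 : discRatio (t 0) (t 1) (t 2) ≠ 0 := right_ne_zero_of_mul hd0
  have m2 : e2 root ∈ adjoin ℚ (Set.range t) := by
    -- The exponent 6 gives `t 3` weight one, so `t 3 ^ 2 = e3² Δ² / e2^12` has the weight of `e2`.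
    -- Substituting `Δ² = e2^10 · discRatio` and `e3² = t 1 · e2³` leaves a relation linear in `e2`.
    have h1 : e2 root = t 3 ^ 2 / (t 1 * discRatio (t 0) (t 1) (t 2)) := by
      have h2 : t 1 ≠ 0 := div_ne_zero (pow_ne_zero 2 h30) (pow_ne_zero 3 h20)
      rw [eq_div_iff (mul_ne_zero h2 hD0)]
      change e2 root * (e3 root ^ 2 / e2 root ^ 3 * discRatio (t 0) (t 1) (t 2)) =
        (e3 root * delta root / e2 root ^ 6) ^ 2
      rw [div_pow, mul_pow, hdisc]
      change _ = e3 root ^ 2 * (e2 root ^ 10 * discRatio (t 0) (t 1) (t 2)) / _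
      field_simp
    rw [h1]
    exact div_mem (pow_mem (hm 3) 2) (mul_mem (hm 1) hD)
  have m4 : e4 root ∈ adjoin ℚ (Set.range t) := by
    have h1 : e4 root = t 0 * e2 root ^ 2 := by simp [ht, h20]
    rw [h1]
    exact mul_mem (hm 0) (pow_mem m2 2)
  have m3 : e3 root ^ 2 ∈ adjoin ℚ (Set.range t) := by
    have h1 : e3 root ^ 2 = t 1 * e2 root ^ 3 := by simp [ht, h20]
    rw [h1]
    exact mul_mem (hm 1) (pow_mem m2 3)
  refine fixedSubfield_eq_adjoin (H := G3) ?_ fixedSubfield_G3.le ?_ (y := e3 root) m3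
    (g := tau2) (Subgroup.subset_closure (by simp)) ?_ ?_
  · rw [G3_eq, G5_eq]
    rintro _ ⟨s, rfl⟩
    refine ⟨s, ?_⟩
    rw [MonoidHom.comp_apply, MonoidHom.comp_apply, signGraph_apply,
      show Perm.sign s.val = 1 from s.2]
    rfl
  · intro i g hg
    rw [G5_eq] at hg
    obtain ⟨s, rfl⟩ := hg
    rw [MonoidHom.comp_apply, signGraph_apply]
    obtain ⟨h2, h3, h4, h5, hΔ⟩ := fieldAction_signedStd_esymm s (Perm.sign s)
    have hu := units_cast_sq (Perm.sign s)
    have hu0 := units_cast_ne_zero (Perm.sign s)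
    fin_cases i
    · change fieldAction _ (e4 root / e2 root ^ 2) = e4 root / e2 root ^ 2
      rw [map_div₀, map_pow, h2, h4]
    · change fieldAction _ (e3 root ^ 2 / e2 root ^ 3) = e3 root ^ 2 / e2 root ^ 3
      rw [map_div₀, map_pow, map_pow, h2, h3, mul_pow, pow_two ((_ : ℤ) : RatFun4), hu, one_mul]
    · change fieldAction _ (e5 root / (e2 root * e3 root)) = e5 root / (e2 root * e3 root)
      rw [map_div₀, map_mul, h2, h3, h5, mul_left_comm, mul_div_mul_left _ _ hu0]
    · change fieldAction _ (e3 root * delta root / e2 root ^ 6) =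
        e3 root * delta root / e2 root ^ 6
      rw [map_div₀, map_pow, map_mul, h2, h3, hΔ, mul_mul_mul_comm, hu, one_mul]
  · rw [tau2_eq_signedStd, (fieldAction_signedStd_esymm (swap 0 1) (-1)).2.1]
    simp
  · intro z hz
    rcases hz with rfl | rfl | rfl | rfl | rfl
    · exact ⟨_, m2, 0, zero_mem _, by simp⟩
    · exact ⟨0, zero_mem _, 1, one_mem _, by simp⟩
    · exact ⟨_, m4, 0, zero_mem _, by simp⟩
    · refine ⟨0, zero_mem _, _, mul_mem (hm 2) m2, ?_⟩
      change e5 root = 0 + e5 root / (e2 root * e3 root) * e2 root * e3 root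
      field_simp
      ring
    · refine ⟨0, zero_mem _, _, div_mem (mul_mem (hm 3) (pow_mem m2 6)) m3, ?_⟩
      change delta root = 0 + e3 root * delta root / e2 root ^ 6 * e2 root ^ 6 / e3 root ^ 2 *
        e3 root
      field_simp
      ring

theorem isRational_G5 : IsRational ℚ (fixedSubfield G5) :=
  have : Finite G5 := by rw [G5_eq]; exact finite_range _
  isRational_of_eq_adjoin fixedSubfield_G5

theorem isRational_G7 : IsRational ℚ (fixedSubfield G7) :=
  have : Finite G7 := by rw [G7_eq]; exact finite_range _
  isRational_of_eq_adjoin fixedSubfield_G7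

end FourDimLinear

namespace FourDimLinear

open IntermediateField

/-! ### The Sylvester form of a quintic

A generic quintic is `∑ κ_i (X - r_i)^5` for the three roots `r_i = y_i - k` of a cubic, where
`y_i` are the roots of `Y^3 + p Y + q`, and `κ_i = (n + k y_i + y_i^2) / (3 y_i^2 + p)`. -/

section Sylvester

section Definitions

variable {R : Type*} [CommRing R] (k p q n : R)

/-- The second moment `∑ κ_i r_i^2`. -/
def mom2 : R := n - p - k ^ 2

/-- The third moment `∑ κ_i r_i^3`. -/
def mom3 : R := -p * k - q - 3 * k * mom2 k p n - k ^ 3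

/-- The fourth moment `∑ κ_i r_i^4`. -/
def mom4 : R :=
  -p * (n - p) - q * k - 4 * k * mom3 k p q n - 6 * k ^ 2 * mom2 k p n - k ^ 4

/-- The fifth moment `∑ κ_i r_i^5`. -/
def mom5 : R :=
  p * (p * k + q) - q * (n - p) - 5 * k * mom4 k p q n - 10 * k ^ 2 * mom3 k p q n -
    10 * k ^ 3 * mom2 k p n - k ^ 5

/-- The discriminant of `Y^3 + p Y + q`. -/
def discCubic : R := -4 * p ^ 3 - 27 * q ^ 2

/-- The norm of `n + k y + y^2`. -/
def invH : R :=
  -k ^ 3 * q + k ^ 2 * p * n - k * p * q + 3 * k * q * n + p ^ 2 * n - 2 * p * n ^ 2 + q ^ 2 + n ^ 3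

/-- Up to the square of the discriminant, the second symmetric function of the conjugates of
`(n + k y + y^2) (3 y^2 + p)^4`. -/
def invS : R :=
  16 * k ^ 2 * p ^ 3 + 27 * k ^ 2 * q ^ 2 + 18 * k * p ^ 2 * q + 27 * k * p * q * n + 16 * p ^ 4 -
    34 * p ^ 3 * n + 18 * p ^ 2 * n ^ 2 + 54 * p * q ^ 2 - 27 * q ^ 2 * n

/-- The invariant of degree four of the quintic. -/
def invJ : R :=
  -64 * k ^ 4 * p ^ 3 + 9 * k ^ 4 * q ^ 2 - 112 * k ^ 3 * p ^ 2 * q - 42 * k ^ 3 * p * q * n -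
    128 * k ^ 2 * p ^ 4 + 240 * k ^ 2 * p ^ 3 * n - 111 * k ^ 2 * p ^ 2 * n ^ 2 -
    72 * k ^ 2 * p * q ^ 2 - 54 * k ^ 2 * q ^ 2 * n - 112 * k * p ^ 3 * q +
    168 * k * p ^ 2 * q * n - 18 * k * p * q * n ^ 2 - 36 * k * q ^ 3 - 36 * k * q * n ^ 3 -
    64 * p ^ 5 + 240 * p ^ 4 * n - 336 * p ^ 3 * n ^ 2 - 32 * p ^ 2 * q ^ 2 +
    208 * p ^ 2 * n ^ 3 + 60 * p * q ^ 2 * n - 48 * p * n ^ 4 - 27 * q ^ 2 * n ^ 2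

/-- The constant coefficient of `(n + k y + y^2) (3 y^2 + p)^4`. -/
def coef0 : R :=
  15 * k * p ^ 3 * q - 81 * k * q ^ 3 + p ^ 4 * n + 81 * p ^ 2 * q ^ 2 - 54 * p * q ^ 2 * n

/-- The linear coefficient of `(n + k y + y^2) (3 y^2 + p)^4`. -/
def coef1 : R :=
  16 * k * p ^ 4 - 135 * k * p * q ^ 2 + 96 * p ^ 3 * q - 81 * p ^ 2 * q * n - 81 * q ^ 3

/-- The quadratic coefficient of `(n + k y + y^2) (3 y^2 + p)^4`. -/
def coef2 : R :=
  -81 * k * p ^ 2 * q + 16 * p ^ 4 - 15 * p ^ 3 * n - 135 * p * q ^ 2 + 81 * q ^ 2 * n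

/-- The trace of `(n + k y + y^2) (3 y^2 + p)^4`. -/
def trA : R := 3 * coef0 k p q n - 2 * p * coef2 k p q n

/-- The arguments are the coefficients of `∑ κ_i (X - r_i)^5`, whose moments of order zero and one
are `1` and `0`. Rescaling the linear forms `X - r_i` to have sum zero multiplies `κ_i` by a common
factor times `(3 y_i² + p)^5`, which yields the conjugates `α_i` of `(n + k y + y²)(3 y² + p)^4`.
For Sylvester's form the discriminant is, up to a factor, `J² - 128 K` with `J = ε2² - 4 ε1 ε3` and
`K = ε3² ε2` in the symmetric functions `ε` of the `α_i`. -/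
theorem disc5_moments : disc5 (10 * mom2 k p n) (10 * mom3 k p q n) (5 * mom4 k p q n)
    (mom5 k p q n) = 3125 * (invJ k p q n ^ 2 - 128 * invH k p q n ^ 2 * invS k p q n) := by
  simp only [disc5, mom5, mom4, mom3, mom2, invJ, invH, invS]
  ring

/-- This is `4 ε1 ε3 = ε2² - J` for the conjugates `α_i`, after removal of powers of the
discriminant of the cubic. -/
theorem four_mul_invH_mul_trA : 4 * invH k p q n * trA k p q n =
    invS k p q n ^ 2 - discCubic p q * invJ k p q n := by
  simp only [trA, coef0, coef2, discCubic, invJ, invH, invS]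
  ring

theorem esymm2_coef : discCubic p q ^ 2 * invS k p q n =
    3 * coef0 k p q n ^ 2 - 4 * p * coef0 k p q n * coef2 k p q n + p * coef1 k p q n ^ 2 +
      3 * q * coef1 k p q n * coef2 k p q n + p ^ 2 * coef2 k p q n ^ 2 := by
  simp only [coef0, coef1, coef2, discCubic, invS]
  ring

theorem esymm3_coef : discCubic p q ^ 4 * invH k p q n =
    coef0 k p q n ^ 3 - 2 * p * coef0 k p q n ^ 2 * coef2 k p q n +
      coef0 k p q n * (p * coef1 k p q n ^ 2 + 3 * q * coef1 k p q n * coef2 k p q n +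
        p ^ 2 * coef2 k p q n ^ 2) -
      q * (coef1 k p q n ^ 3 + p * coef1 k p q n * coef2 k p q n ^ 2 -
        q * coef2 k p q n ^ 3) := by
  simp only [coef0, coef1, coef2, discCubic, invH]
  ring

end Definitions

end Sylvester

end FourDimLinear

/-! ### The Möbius parameters and the inversion formulas for the generators of the `A_5`-invariants.
-/

namespace FourDimLinear

open IntermediateField

section Generators

variable {L : Type*} [Field L] (k p q n D : L)

/-- The pole of the Möbius transformation relating the two triples of conjugates. -/
def moebMu : L := coef1 k p q n / coef2 k p q n

/-- The value at infinity of the Möbius transformation relating the two triples. -/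
def moebW : L := coef0 k p q n - coef1 k p q n * moebMu k p q n - coef2 k p q n * p

/-- The residue of the Möbius transformation relating the two triples. -/
def moebNu : L := -coef2 k p q n * (moebMu k p q n ^ 3 + p * moebMu k p q n + q)

/-- The four generators of the field of invariants of the alternating group. -/
def gen : Fin 4 → L :=
  ![discCubic p q * invJ k p q n / invS k p q n ^ 2, D / invJ k p q n,
    moebW k p q n / trA k p q n, moebNu k p q n / trA k p q n]

theorem map_discCubic {R S : Type*} [CommRing R] [CommRing S] (f : R →+* S) (p q : R) :
    f (discCubic p q) = discCubic (f p) (f q) := by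
  simp only [discCubic, map_sub, map_mul, map_neg, map_pow, map_ofNat]

theorem map_invJ {R S : Type*} [CommRing R] [CommRing S] (f : R →+* S) (k p q n : R) :
    f (invJ k p q n) = invJ (f k) (f p) (f q) (f n) := by
  simp only [invJ, map_add, map_sub, map_mul, map_neg, map_pow, map_ofNat]

theorem map_gen {L' : Type*} [Field L'] (f : L →+* L') (i : Fin 4) :
    f (gen k p q n D i) = gen (f k) (f p) (f q) (f n) (f D) i := by
  fin_cases i
  · change f (discCubic p q * invJ k p q n / invS k p q n ^ 2) =
      discCubic _ _ * invJ _ _ _ _ / invS _ _ _ _ ^ 2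
    simp only [discCubic, invJ, invS, map_div₀, map_add, map_sub, map_mul, map_neg, map_pow,
      map_ofNat]
  · change f (D / invJ k p q n) = f D / invJ _ _ _ _
    simp only [invJ, map_div₀, map_add, map_sub, map_mul, map_neg, map_pow, map_ofNat]
  · change f (moebW k p q n / trA k p q n) = moebW _ _ _ _ / trA _ _ _ _
    simp only [moebW, moebMu, trA, coef0, coef1, coef2, map_div₀, map_add, map_sub, map_mul,
      map_neg, map_pow, map_ofNat]
  · change f (moebNu k p q n / trA k p q n) = moebNu _ _ _ _ / trA _ _ _ _
    simp only [moebNu, moebMu, trA, coef0, coef1, coef2, map_div₀, map_add, map_sub, map_mul,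
      map_neg, map_pow, map_ofNat]

theorem coef1_eq (h : coef2 k p q n ≠ 0) :
    coef1 k p q n = moebMu k p q n * coef2 k p q n := by
  rw [moebMu, div_mul_cancel₀ _ h]

theorem coef0_eq : coef0 k p q n =
    moebW k p q n + coef1 k p q n * moebMu k p q n + coef2 k p q n * p := by
  rw [moebW]
  ring

/-- With `α = coef0 + coef1 y + coef2 y²` and `y³ + p y + q = 0` one has `(α - w)(y - μ) = ν`. Hence
the symmetric functions of the `α_i - w` are `a2 (3μ² + p)`, `-3 μ a2 ν` and `a2 ν²`, where `a2 =
coef2`; this lemma and the next two shift them back by `w`. -/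
theorem trA_eq (h : coef2 k p q n ≠ 0) :
    trA k p q n = 3 * moebW k p q n + coef2 k p q n * (3 * moebMu k p q n ^ 2 + p) := by
  rw [trA, coef0_eq, coef1_eq k p q n h]
  ring

theorem esymm2_eq (h : coef2 k p q n ≠ 0) : discCubic p q ^ 2 * invS k p q n =
    -3 * moebMu k p q n * coef2 k p q n * moebNu k p q n +
      2 * moebW k p q n * (trA k p q n - 3 * moebW k p q n) + 3 * moebW k p q n ^ 2 := by
  rw [esymm2_coef, trA_eq k p q n h, coef0_eq, coef1_eq k p q n h, moebNu]
  ring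

theorem esymm3_eq (h : coef2 k p q n ≠ 0) : discCubic p q ^ 4 * invH k p q n =
    coef2 k p q n * moebNu k p q n ^ 2 +
      moebW k p q n * (-3 * moebMu k p q n * coef2 k p q n * moebNu k p q n) +
      moebW k p q n ^ 2 * (trA k p q n - 3 * moebW k p q n) + moebW k p q n ^ 3 := by
  rw [esymm3_coef, trA_eq k p q n h, coef0_eq, coef1_eq k p q n h, moebNu]
  ring

/-- The coefficients of `1` in `coef0, coef1, coef2` can be recovered by Cramer's rule. -/
theorem discCubic_pow_four {R : Type*} [CommRing R] (k p q n : R) : discCubic p q ^ 4 =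
    (-81 * p ^ 2 * q * (-81 * p ^ 2 * q) - (16 * p ^ 4 - 135 * p * q ^ 2) *
      (-15 * p ^ 3 + 81 * q ^ 2)) * coef0 k p q n -
    ((p ^ 4 - 54 * p * q ^ 2) * (-81 * p ^ 2 * q) - (15 * p ^ 3 * q - 81 * q ^ 3) *
      (-15 * p ^ 3 + 81 * q ^ 2)) * coef1 k p q n +
    ((p ^ 4 - 54 * p * q ^ 2) * (16 * p ^ 4 - 135 * p * q ^ 2) - (15 * p ^ 3 * q - 81 * q ^ 3) *
      (-81 * p ^ 2 * q)) * coef2 k p q n := by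
  simp only [coef0, coef1, coef2, discCubic]
  ring

theorem discCubic_pow_four_mul_k {R : Type*} [CommRing R] (k p q n : R) :
    discCubic p q ^ 4 * k =
    -(-81 * p ^ 2 * q * (16 * p ^ 4 - 135 * p * q ^ 2) - (96 * p ^ 3 * q - 81 * q ^ 3) *
      (-15 * p ^ 3 + 81 * q ^ 2)) * coef0 k p q n +
    ((p ^ 4 - 54 * p * q ^ 2) * (16 * p ^ 4 - 135 * p * q ^ 2) - 81 * p ^ 2 * q ^ 2 *
      (-15 * p ^ 3 + 81 * q ^ 2)) * coef1 k p q n -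
    ((p ^ 4 - 54 * p * q ^ 2) * (96 * p ^ 3 * q - 81 * q ^ 3) - 81 * p ^ 2 * q ^ 2 *
      (-81 * p ^ 2 * q)) * coef2 k p q n := by
  simp only [coef0, coef1, coef2, discCubic]
  ring

theorem discCubic_pow_four_mul_n {R : Type*} [CommRing R] (k p q n : R) :
    discCubic p q ^ 4 * n =
    ((16 * p ^ 4 - 135 * p * q ^ 2) * (16 * p ^ 4 - 135 * p * q ^ 2) -
      (96 * p ^ 3 * q - 81 * q ^ 3) * (-81 * p ^ 2 * q)) * coef0 k p q n -
    ((15 * p ^ 3 * q - 81 * q ^ 3) * (16 * p ^ 4 - 135 * p * q ^ 2) - 81 * p ^ 2 * q ^ 2 *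
      (-81 * p ^ 2 * q)) * coef1 k p q n +
    ((15 * p ^ 3 * q - 81 * q ^ 3) * (96 * p ^ 3 * q - 81 * q ^ 3) - 81 * p ^ 2 * q ^ 2 *
      (16 * p ^ 4 - 135 * p * q ^ 2)) * coef2 k p q n := by
  simp only [coef0, coef1, coef2, discCubic]
  ring

variable {F : Type*} [Field F] [Algebra F L] {K : IntermediateField F L}

theorem discCubic_mem (hp : p ∈ K) (hq : q ∈ K) : discCubic p q ∈ K := by
  have h := map_discCubic (algebraMap K L) ⟨p, hp⟩ ⟨q, hq⟩
  change _ = discCubic p q at h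
  exact h ▸ (discCubic (⟨p, hp⟩ : K) ⟨q, hq⟩).2

theorem invJ_mem (hk : k ∈ K) (hp : p ∈ K) (hq : q ∈ K) (hn : n ∈ K) : invJ k p q n ∈ K := by
  have h := map_invJ (algebraMap K L) ⟨k, hk⟩ ⟨p, hp⟩ ⟨q, hq⟩ ⟨n, hn⟩
  change _ = invJ k p q n at h
  exact h ▸ (invJ (⟨k, hk⟩ : K) ⟨p, hp⟩ ⟨q, hq⟩ ⟨n, hn⟩).2

theorem cramer_one_mem {p q a0 a1 a2 : L} (hp : p ∈ K) (hq : q ∈ K) (h0 : a0 ∈ K) (h1 : a1 ∈ K)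
    (h2 : a2 ∈ K) :
    (-81 * p ^ 2 * q * (-81 * p ^ 2 * q) - (16 * p ^ 4 - 135 * p * q ^ 2) *
      (-15 * p ^ 3 + 81 * q ^ 2)) * a0 -
    ((p ^ 4 - 54 * p * q ^ 2) * (-81 * p ^ 2 * q) - (15 * p ^ 3 * q - 81 * q ^ 3) *
      (-15 * p ^ 3 + 81 * q ^ 2)) * a1 +
    ((p ^ 4 - 54 * p * q ^ 2) * (16 * p ^ 4 - 135 * p * q ^ 2) - (15 * p ^ 3 * q - 81 * q ^ 3) *
      (-81 * p ^ 2 * q)) * a2 ∈ K := by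
  have (m : ℕ) [m.AtLeastTwo] : (OfNat.ofNat m : L) ∈ K := ofNat_mem K m
  repeat' first
    | assumption | exact this _ | apply sub_mem | apply add_mem | apply mul_mem | apply neg_mem
    | apply pow_mem

theorem cramer_k_mem {p q a0 a1 a2 : L} (hp : p ∈ K) (hq : q ∈ K) (h0 : a0 ∈ K) (h1 : a1 ∈ K)
    (h2 : a2 ∈ K) :
    -(-81 * p ^ 2 * q * (16 * p ^ 4 - 135 * p * q ^ 2) - (96 * p ^ 3 * q - 81 * q ^ 3) *
      (-15 * p ^ 3 + 81 * q ^ 2)) * a0 +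
    ((p ^ 4 - 54 * p * q ^ 2) * (16 * p ^ 4 - 135 * p * q ^ 2) - 81 * p ^ 2 * q ^ 2 *
      (-15 * p ^ 3 + 81 * q ^ 2)) * a1 -
    ((p ^ 4 - 54 * p * q ^ 2) * (96 * p ^ 3 * q - 81 * q ^ 3) - 81 * p ^ 2 * q ^ 2 *
      (-81 * p ^ 2 * q)) * a2 ∈ K := by
  have (m : ℕ) [m.AtLeastTwo] : (OfNat.ofNat m : L) ∈ K := ofNat_mem K m
  repeat' first
    | assumption | exact this _ | apply sub_mem | apply add_mem | apply mul_mem | apply neg_mem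
    | apply pow_mem

theorem cramer_n_mem {p q a0 a1 a2 : L} (hp : p ∈ K) (hq : q ∈ K) (h0 : a0 ∈ K) (h1 : a1 ∈ K)
    (h2 : a2 ∈ K) :
    ((16 * p ^ 4 - 135 * p * q ^ 2) * (16 * p ^ 4 - 135 * p * q ^ 2) -
      (96 * p ^ 3 * q - 81 * q ^ 3) * (-81 * p ^ 2 * q)) * a0 -
    ((15 * p ^ 3 * q - 81 * q ^ 3) * (16 * p ^ 4 - 135 * p * q ^ 2) - 81 * p ^ 2 * q ^ 2 *
      (-81 * p ^ 2 * q)) * a1 +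
    ((15 * p ^ 3 * q - 81 * q ^ 3) * (96 * p ^ 3 * q - 81 * q ^ 3) - 81 * p ^ 2 * q ^ 2 *
      (16 * p ^ 4 - 135 * p * q ^ 2)) * a2 ∈ K := by
  have (m : ℕ) [m.AtLeastTwo] : (OfNat.ofNat m : L) ∈ K := ofNat_mem K m
  repeat' first
    | assumption | exact this _ | apply sub_mem | apply add_mem | apply mul_mem | apply neg_mem
    | apply pow_mem

/-- The generators determine, in turn, the cubic of the `α_i / T`, then the Möbius transformation
and with it `p, q`, then the scale `T`, and finally `k, n, D`. -/
theorem rat_mem_of_gen_mem [CharZero L] (hd : discCubic p q ≠ 0) (hS : invS k p q n ≠ 0)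
    (hJ : invJ k p q n ≠ 0) (hH : invH k p q n ≠ 0) (hT : trA k p q n ≠ 0)
    (h2 : coef2 k p q n ≠ 0) (hν : moebNu k p q n ≠ 0)
    (hD : D ^ 2 = 3125 * (invJ k p q n ^ 2 - 128 * invH k p q n ^ 2 * invS k p q n))
    (hK : ∀ i, gen k p q n D i ∈ K) : k ∈ K ∧ p ∈ K ∧ q ∈ K ∧ n ∈ K ∧ D ∈ K := by
  have mP : discCubic p q * invJ k p q n / invS k p q n ^ 2 ∈ K := hK 0
  have mD : D / invJ k p q n ∈ K := hK 1
  have mu : moebW k p q n / trA k p q n ∈ K := hK 2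
  have mt : moebNu k p q n / trA k p q n ∈ K := hK 3
  have hPHS := four_mul_invH_mul_trA k p q n
  have e2' := esymm2_eq k p q n h2
  have e3' := esymm3_eq k p q n h2
  have eT := trA_eq k p q n h2
  have c1' := coef1_eq k p q n h2
  have c0' := coef0_eq k p q n
  have hν' : moebNu k p q n =
    -coef2 k p q n * (moebMu k p q n ^ 3 + p * moebMu k p q n + q) := rfl
  have dJ (x : L) : discCubic p q ^ 4 * x / discCubic p q ^ 4 = x :=
    mul_div_cancel_left₀ _ (pow_ne_zero 4 hd)
  have k1 := discCubic_pow_four k p q n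
  have k2 := discCubic_pow_four_mul_k k p q n
  have k3 := discCubic_pow_four_mul_n k p q n
  set d := discCubic p q with hd_def
  set S := invS k p q n
  set J := invJ k p q n with hJ_def
  set H := invH k p q n
  set T := trA k p q n
  set a0 := coef0 k p q n
  set a1 := coef1 k p q n
  set a2 := coef2 k p q n
  set w := moebW k p q n
  set ν := moebNu k p q n
  set μ := moebMu k p q n
  have mnum (m : ℕ) [m.AtLeastTwo] : (OfNat.ofNat m : L) ∈ K := ofNat_mem K m
  have mρ : H ^ 2 * S / J ^ 2 ∈ K := by
    have h1 : H ^ 2 * S / J ^ 2 = (1 - (D / J) ^ 2 / 3125) / 128 := by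
      rw [div_pow, hD]
      field_simp
      ring
    rw [h1]
    exact div_mem (sub_mem (one_mem _) (div_mem (pow_mem mD 2) (mnum _))) (mnum _)
  have hP1 : 1 - d * J / S ^ 2 = 4 * H * T / S ^ 2 := by
    rw [hPHS]
    field_simp
  -- `ε2 / T²`, found from the relation `16 P² ρ = (1 - P)² ε2 / T²` with `P = dJ/S²` and `ρ = H² S
  -- / J²`. The next quantity is `ε3 / T³ = (1 - P)/4 · (ε2 / T²)²`.
  have ms2 : d ^ 2 * S / T ^ 2 ∈ K := by
    have h1 : d ^ 2 * S / T ^ 2 =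
        16 * (d * J / S ^ 2) ^ 2 * (H ^ 2 * S / J ^ 2) / (1 - d * J / S ^ 2) ^ 2 := by
      rw [hP1]
      field_simp
      ring
    rw [h1]
    exact div_mem (mul_mem (mul_mem (mnum _) (pow_mem mP 2)) mρ)
      (pow_mem (sub_mem (one_mem _) mP) 2)
  have ms3 : d ^ 4 * H / T ^ 3 ∈ K := by
    have h1 : d ^ 4 * H / T ^ 3 = (1 - d * J / S ^ 2) / 4 * (d ^ 2 * S / T ^ 2) ^ 2 := by
      rw [hP1]
      field_simp
    rw [h1]
    exact mul_mem (div_mem (sub_mem (one_mem _) mP) (mnum _)) (pow_mem ms2 2)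
  -- The three symmetric functions of the `(α_i - w) / T`. Together with `ν / T` they give `a2 / T`,
  -- `μ`, `p` and `q`.
  have mε1 : a2 * (3 * μ ^ 2 + p) / T ∈ K := by
    have h1 : a2 * (3 * μ ^ 2 + p) / T = 1 - 3 * (w / T) := by
      field_simp
      linear_combination -eT
    rw [h1]
    exact sub_mem (one_mem _) (mul_mem (mnum _) mu)
  have mε2 : -3 * μ * a2 * ν / T ^ 2 ∈ K := by
    have h1 : -3 * μ * a2 * ν / T ^ 2 =
        d ^ 2 * S / T ^ 2 - 2 * (w / T) * (1 - 3 * (w / T)) - 3 * (w / T) ^ 2 := by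
      field_simp
      linear_combination -e2'
    rw [h1]
    exact sub_mem (sub_mem ms2 (mul_mem (mul_mem (mnum _) mu)
      (sub_mem (one_mem _) (mul_mem (mnum _) mu)))) (mul_mem (mnum _) (pow_mem mu 2))
  have mε3 : a2 * ν ^ 2 / T ^ 3 ∈ K := by
    have h1 : a2 * ν ^ 2 / T ^ 3 = d ^ 4 * H / T ^ 3 - w / T * (-3 * μ * a2 * ν / T ^ 2) -
        (w / T) ^ 2 * (1 - 3 * (w / T)) - (w / T) ^ 3 := by
      field_simp
      linear_combination -e3'
    rw [h1]
    exact sub_mem (sub_mem (sub_mem ms3 (mul_mem mu mε2)) (mul_mem (pow_mem mu 2)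
      (sub_mem (one_mem _) (mul_mem (mnum _) mu)))) (pow_mem mu 3)
  have ma2 : a2 / T ∈ K := by
    have h1 : a2 / T = a2 * ν ^ 2 / T ^ 3 / (ν / T) ^ 2 := by field_simp
    rw [h1]
    exact div_mem mε3 (pow_mem mt 2)
  have mμ : μ ∈ K := by
    have h1 : μ = -(-3 * μ * a2 * ν / T ^ 2) / (3 * (a2 / T) * (ν / T)) := by
      field_simp
    rw [h1]
    exact div_mem (neg_mem mε2) (mul_mem (mul_mem (mnum _) ma2) mt)
  have mp : p ∈ K := by
    have h1 : p = a2 * (3 * μ ^ 2 + p) / T / (a2 / T) - 3 * μ ^ 2 := by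
      field_simp
      ring
    rw [h1]
    exact sub_mem (div_mem mε1 ma2) (mul_mem (mnum _) (pow_mem mμ 2))
  have mq : q ∈ K := by
    have h1 : q = -(ν / T / (a2 / T)) - μ ^ 3 - p * μ := by
      rw [hν']
      field_simp
      ring
    rw [h1]
    exact sub_mem (sub_mem (neg_mem (div_mem mt ma2)) (pow_mem mμ 3)) (mul_mem mp mμ)
  have ma1 : a1 / T ∈ K := by
    rw [c1', mul_div_assoc]
    exact mul_mem mμ ma2
  have ma0 : a0 / T ∈ K := by
    have h1 : a0 / T = w / T + a1 / T * μ + a2 / T * p := by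
      rw [c0']
      ring
    rw [h1]
    exact add_mem (add_mem mu (mul_mem ma1 mμ)) (mul_mem ma2 mp)
  have md : d ∈ K := discCubic_mem p q mp mq
  -- The coefficients of `α` are linear in `1, k, n` over the field of `p, q`, with determinant
  -- `d^4` up to sign. Dividing them by `T` and applying Cramer's rule gives `1 / T`.
  have mT : T ∈ K := by
    have h2 (u v w : L) : (u * a0 - v * a1 + w * a2) * T⁻¹ =
        u * (a0 / T) - v * (a1 / T) + w * (a2 / T) := by ring
    have h3 : d ^ 4 * T⁻¹ ∈ K := by
      rw [k1, h2]
      exact cramer_one_mem mp mq ma0 ma1 ma2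
    rw [← inv_inv T, ← dJ T⁻¹]
    exact inv_mem (div_mem h3 (pow_mem md 4))
  have hmul {x : L} (hx : x / T ∈ K) : x ∈ K := by
    rw [← div_mul_cancel₀ x hT]
    exact mul_mem hx mT
  have mk : k ∈ K := by
    rw [← dJ k, k2]
    exact div_mem (cramer_k_mem mp mq (hmul ma0) (hmul ma1) (hmul ma2)) (pow_mem md 4)
  have mn : n ∈ K := by
    rw [← dJ n, k3]
    exact div_mem (cramer_n_mem mp mq (hmul ma0) (hmul ma1) (hmul ma2)) (pow_mem md 4)
  have mJ : J ∈ K := invJ_mem k p q n mk mp mq mn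
  refine ⟨mk, mp, mq, mn, ?_⟩
  rw [← div_mul_cancel₀ D hJ]
  exact mul_mem mD mJ

theorem gen_mem (hk : k ∈ K) (hp : p ∈ K) (hq : q ∈ K) (hn : n ∈ K) (hD : D ∈ K) (i : Fin 4) :
    gen k p q n D i ∈ K := by
  have h := map_gen (⟨k, hk⟩ : K) ⟨p, hp⟩ ⟨q, hq⟩ ⟨n, hn⟩ ⟨D, hD⟩ (algebraMap K L) i
  change _ = gen k p q n D i at h
  exact h ▸ (gen (⟨k, hk⟩ : K) ⟨p, hp⟩ ⟨q, hq⟩ ⟨n, hn⟩ ⟨D, hD⟩ i).2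

theorem map_gen_of_odd {φ : L →+* L} (hk : φ k = -k) (hp : φ p = p) (hq : φ q = -q)
    (hn : φ n = n) (hD : φ D = D) :
    φ (gen k p q n D 0) = gen k p q n D 0 ∧ φ (gen k p q n D 1) = gen k p q n D 1 ∧
      φ (gen k p q n D 2) = gen k p q n D 2 ∧ φ (gen k p q n D 3) = -gen k p q n D 3 := by
  have h0 : φ (coef0 k p q n) = coef0 k p q n := by
    simp only [coef0, map_add, map_sub, map_mul, map_pow, map_ofNat, hk, hp, hq, hn]
    ring
  have h1 : φ (coef1 k p q n) = -coef1 k p q n := by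
    simp only [coef1, map_add, map_sub, map_mul, map_pow, map_ofNat, hk, hp, hq, hn]
    ring
  have h2 : φ (coef2 k p q n) = coef2 k p q n := by
    simp only [coef2, map_add, map_sub, map_mul, map_neg, map_pow, map_ofNat, hk, hp, hq, hn]
    ring
  have hT : φ (trA k p q n) = trA k p q n := by
    simp only [trA, map_sub, map_mul, map_ofNat, h0, h2, hp]
  have hd : φ (discCubic p q) = discCubic p q := by
    simp only [discCubic, map_sub, map_mul, map_neg, map_pow, map_ofNat, hp, hq]
    ring
  have hS : φ (invS k p q n) = invS k p q n := by
    simp only [invS, map_add, map_sub, map_mul, map_pow, map_ofNat, hk, hp, hq, hn]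
    ring
  have hJ : φ (invJ k p q n) = invJ k p q n := by
    simp only [invJ, map_add, map_sub, map_mul, map_neg, map_pow, map_ofNat, hk, hp, hq, hn]
    ring
  have hμ : φ (moebMu k p q n) = -moebMu k p q n := by
    rw [moebMu, map_div₀, h1, h2, neg_div]
  have hw : φ (moebW k p q n) = moebW k p q n := by
    simp only [moebW, map_sub, map_mul, h0, h1, h2, hμ, hp]
    ring
  have hν : φ (moebNu k p q n) = -moebNu k p q n := by
    simp only [moebNu, map_add, map_mul, map_neg, map_pow, h2, hμ, hp, hq]
    ring
  refine ⟨?_, ?_, ?_, ?_⟩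
  · change φ (discCubic p q * invJ k p q n / invS k p q n ^ 2) = _
    rw [map_div₀, map_mul, map_pow, hd, hJ, hS]
    rfl
  · change φ (D / invJ k p q n) = _
    rw [map_div₀, hD, hJ]
    rfl
  · change φ (moebW k p q n / trA k p q n) = _
    rw [map_div₀, hw, hT]
    rfl
  · change φ (moebNu k p q n / trA k p q n) = -(moebNu k p q n / trA k p q n)
    rw [map_div₀, hν, hT, neg_div]

end Generators

end FourDimLinear

namespace FourDimLinear

open IntermediateField

/-! ### Coordinates of the Sylvester form -/

section Coordinates

variable {L : Type*} [Field L] (a b c d : L)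

/-- The Hankel determinant of the moments `1, 0, a, b, c`. -/
def hankel : L := a * c - b ^ 2 - a ^ 3

/-- The quadratic coefficient of the cubic recurrence of the moments `1, 0, a, b, c, d`. -/
def recA : L := (c * b + a ^ 2 * b - a * d) / hankel a b c

/-- The linear coefficient of the cubic recurrence of the moments. -/
def recB : L := -(c + recA a b c d * b) / a

/-- The translation that centres the cubic of the recurrence. -/
def sylK : L := recA a b c d / 3

/-- The linear coefficient of the centred cubic. -/
def sylP : L := recB a b c d - 3 * sylK a b c d ^ 2

/-- The constant coefficient of the centred cubic. -/
def sylQ : L := -b - recA a b c d * a - sylP a b c d * sylK a b c d - sylK a b c d ^ 3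

/-- The constant coefficient of the numerator of the weights. -/
def sylN : L := a + sylP a b c d + sylK a b c d ^ 2

/-- The moments `1, 0, a, b, c, d` of three points `r_i` obey the linear recurrence given by the
cubic of the `r_i`. Its three instances determine that cubic, and shifting by a third of its
quadratic coefficient removes the quadratic term. -/
theorem mom_syl [CharZero L] (ha : a ≠ 0) (hh : hankel a b c ≠ 0) :
    mom2 (sylK a b c d) (sylP a b c d) (sylN a b c d) = a ∧
    mom3 (sylK a b c d) (sylP a b c d) (sylQ a b c d) (sylN a b c d) = b ∧
    mom4 (sylK a b c d) (sylP a b c d) (sylQ a b c d) (sylN a b c d) = c ∧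
    mom5 (sylK a b c d) (sylP a b c d) (sylQ a b c d) (sylN a b c d) = d := by
  have hA : recA a b c d * hankel a b c = c * b + a ^ 2 * b - a * d := div_mul_cancel₀ _ hh
  have hB : recB a b c d * a = -(c + recA a b c d * b) := div_mul_cancel₀ _ ha
  have hk : 3 * sylK a b c d = recA a b c d := mul_div_cancel₀ _ three_ne_zero
  have hp : recB a b c d = sylP a b c d + 3 * sylK a b c d ^ 2 := by
    rw [sylP]
    ring
  have hq : sylQ a b c d = -b - recA a b c d * a - sylP a b c d * sylK a b c d -
    sylK a b c d ^ 3 := rfl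
  rw [hankel] at hA
  rw [hp] at hB
  rw [← hk] at hA hB hq
  have h2 : mom2 (sylK a b c d) (sylP a b c d) (sylN a b c d) = a := by
    rw [mom2, sylN]
    ring
  have h3 : mom3 (sylK a b c d) (sylP a b c d) (sylQ a b c d) (sylN a b c d) = b := by
    rw [mom3, h2, hq]
    ring
  have h4 : mom4 (sylK a b c d) (sylP a b c d) (sylQ a b c d) (sylN a b c d) = c := by
    rw [mom4, h3, h2, sylN, hq]
    linear_combination -hB
  refine ⟨h2, h3, h4, ?_⟩
  rw [mom5, h4, h3, h2, sylN, hq]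
  refine mul_left_cancel₀ ha ?_
  linear_combination -hA - (b + 2 * a * sylK a b c d) * hB

variable {F : Type*} [Field F] [Algebra F L] {K : IntermediateField F L}

theorem syl_mem (ha : a ∈ K) (hb : b ∈ K) (hc : c ∈ K) (hd : d ∈ K) :
    sylK a b c d ∈ K ∧ sylP a b c d ∈ K ∧ sylQ a b c d ∈ K ∧ sylN a b c d ∈ K := by
  have h3 : (3 : L) ∈ K := ofNat_mem K 3
  have hA : recA a b c d ∈ K :=
    div_mem (sub_mem (add_mem (mul_mem hc hb) (mul_mem (pow_mem ha 2) hb)) (mul_mem ha hd))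
      (sub_mem (sub_mem (mul_mem ha hc) (pow_mem hb 2)) (pow_mem ha 3))
  have hk : sylK a b c d ∈ K := div_mem hA h3
  have hp : sylP a b c d ∈ K :=
    sub_mem (div_mem (neg_mem (add_mem hc (mul_mem hA hb))) ha) (mul_mem h3 (pow_mem hk 2))
  exact ⟨hk, hp, sub_mem (sub_mem (sub_mem (neg_mem hb) (mul_mem hA ha)) (mul_mem hp hk))
    (pow_mem hk 3), add_mem (add_mem ha hp) (pow_mem hk 2)⟩

theorem map_syl_of_odd {a b c d : L} {φ : L →+* L} (ha : φ a = a) (hb : φ b = -b) (hc : φ c = c)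
    (hd : φ d = -d) : φ (sylK a b c d) = -sylK a b c d ∧ φ (sylP a b c d) = sylP a b c d ∧
      φ (sylQ a b c d) = -sylQ a b c d ∧ φ (sylN a b c d) = sylN a b c d := by
  have hh : φ (hankel a b c) = hankel a b c := by
    simp only [hankel, map_sub, map_mul, map_pow, ha, hb, hc]
    ring
  have hA : φ (recA a b c d) = -recA a b c d := by
    simp only [recA, map_div₀, map_add, map_sub, map_mul, map_pow, ha, hb, hc, hd, hh]
    ring
  have hB : φ (recB a b c d) = recB a b c d := by
    simp only [recB, map_div₀, map_neg, map_add, map_mul, ha, hb, hc, hA]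
    ring
  have hk : φ (sylK a b c d) = -sylK a b c d := by
    simp only [sylK, map_div₀, map_ofNat, hA]
    ring
  have hp : φ (sylP a b c d) = sylP a b c d := by
    simp only [sylP, map_sub, map_mul, map_pow, map_ofNat, hB, hk]
    ring
  refine ⟨hk, hp, ?_, ?_⟩
  · simp only [sylQ, map_sub, map_neg, map_mul, map_pow, ha, hb, hA, hp, hk]
    ring
  · simp only [sylN, map_add, map_pow, ha, hp, hk]
    ring

theorem mom_mem {k p q n : L} (hk : k ∈ K) (hp : p ∈ K) (hq : q ∈ K) (hn : n ∈ K) :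
    mom2 k p n ∈ K ∧ mom3 k p q n ∈ K ∧ mom4 k p q n ∈ K ∧ mom5 k p q n ∈ K := by
  have hm (m : ℕ) [m.AtLeastTwo] : (OfNat.ofNat m : L) ∈ K := ofNat_mem K m
  have h2 : mom2 k p n ∈ K := sub_mem (sub_mem hn hp) (pow_mem hk 2)
  have h3 : mom3 k p q n ∈ K := by
    rw [mom3]
    exact sub_mem (sub_mem (sub_mem (mul_mem (neg_mem hp) hk) hq)
      (mul_mem (mul_mem (hm _) hk) h2)) (pow_mem hk 3)
  have h4 : mom4 k p q n ∈ K := by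
    rw [mom4]
    exact sub_mem (sub_mem (sub_mem (sub_mem (mul_mem (neg_mem hp) (sub_mem hn hp))
      (mul_mem hq hk)) (mul_mem (mul_mem (hm _) hk) h3))
      (mul_mem (mul_mem (hm _) (pow_mem hk 2)) h2)) (pow_mem hk 4)
  refine ⟨h2, h3, h4, ?_⟩
  rw [mom5]
  exact sub_mem (sub_mem (sub_mem (sub_mem (sub_mem (mul_mem hp (add_mem (mul_mem hp hk) hq))
    (mul_mem hq (sub_mem hn hp))) (mul_mem (mul_mem (hm _) hk) h4))
    (mul_mem (mul_mem (hm _) (pow_mem hk 2)) h3)) (mul_mem (mul_mem (hm _) (pow_mem hk 3)) h2))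
    (pow_mem hk 5)

theorem _root_.AlgebraicIndependent.aeval_ne_zero {ι : Type*} {t : ι → L}
    (ht : AlgebraicIndependent F t) (v : ι → F) {f : MvPolynomial ι F} (hf : eval v f ≠ 0) :
    aeval t f ≠ 0 := fun h =>
  hf (by rw [(injective_iff_map_eq_zero _).1 ht f h, map_zero])

variable [CharZero F]

/-- This is `1000` times `hankel (a / 10) (b / 10) (c / 5)`. At `(1, 0, 1, 0)` it takes the value
`19`. -/
theorem hankel_ne_zero {a b c d : L} (ht : AlgebraicIndependent F ![a, b, c, d]) :
    20 * a * c - 10 * b ^ 2 - a ^ 3 ≠ 0 := by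
  have h := ht.aeval_ne_zero ![1, 0, 1, 0]
    (f := 20 * X 0 * X 2 - 10 * X 1 ^ 2 - X 0 ^ 3) (by
      simp only [map_sub, map_mul, map_pow, map_ofNat, eval_X]
      norm_num [Matrix.cons_val_two])
  simp only [map_sub, map_mul, map_pow, map_ofNat, aeval_X] at h
  exact h

theorem inv_ne_zero_of_algebraicIndependent {k p q n : L}
    (ht : AlgebraicIndependent F ![k, p, q, n]) :
    discCubic p q ≠ 0 ∧ invS k p q n ≠ 0 ∧ invJ k p q n ≠ 0 ∧ invH k p q n ≠ 0 ∧
      trA k p q n ≠ 0 ∧ coef2 k p q n ≠ 0 ∧ moebNu k p q n ≠ 0 := by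
  have hd := ht.aeval_ne_zero (fun _ => 1) (f := discCubic (X 1) (X 2)) (by
    simp only [discCubic, map_sub, map_mul, map_neg, map_pow, map_ofNat, eval_X]
    norm_num)
  have hS := ht.aeval_ne_zero (fun _ => 1) (f := invS (X 0) (X 1) (X 2) (X 3)) (by
    simp only [invS, map_add, map_sub, map_mul, map_pow, map_ofNat, eval_X]
    norm_num)
  have hJ := ht.aeval_ne_zero (fun _ => 1) (f := invJ (X 0) (X 1) (X 2) (X 3)) (by
    simp only [invJ, map_add, map_sub, map_mul, map_neg, map_pow, map_ofNat, eval_X]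
    norm_num)
  have hH := ht.aeval_ne_zero (fun _ => 1) (f := invH (X 0) (X 1) (X 2) (X 3)) (by
    simp only [invH, map_add, map_sub, map_mul, map_neg, map_pow, map_ofNat, eval_X]
    norm_num)
  have hT := ht.aeval_ne_zero (fun _ => 1) (f := trA (X 0) (X 1) (X 2) (X 3)) (by
    simp only [trA, coef0, coef2, map_add, map_sub, map_mul, map_neg, map_pow, map_ofNat, eval_X]
    norm_num)
  have h2 := ht.aeval_ne_zero (fun _ => 1) (f := coef2 (X 0) (X 1) (X 2) (X 3)) (by
    simp only [coef2, map_add, map_sub, map_mul, map_neg, map_pow, map_ofNat, eval_X]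
    norm_num)
  -- `moebNu` has `coef2` in the denominator, so the polynomial `-coef2² · moebNu` is specialized
  -- instead.
  have hν := ht.aeval_ne_zero (fun _ => 1) (f := coef1 (X 0) (X 1) (X 2) (X 3) ^ 3 +
      X 1 * coef1 (X 0) (X 1) (X 2) (X 3) * coef2 (X 0) (X 1) (X 2) (X 3) ^ 2 +
      X 2 * coef2 (X 0) (X 1) (X 2) (X 3) ^ 3) (by
    simp only [coef1, coef2, map_add, map_sub, map_mul, map_neg, map_pow, map_ofNat, eval_X]
    norm_num)
  simp only [discCubic, map_sub, map_mul, map_neg, map_pow, map_ofNat, aeval_X] at hd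
  simp only [invS, map_add, map_sub, map_mul, map_pow, map_ofNat, aeval_X] at hS
  simp only [invJ, map_add, map_sub, map_mul, map_neg, map_pow, map_ofNat, aeval_X] at hJ
  simp only [invH, map_add, map_sub, map_mul, map_neg, map_pow, map_ofNat, aeval_X] at hH
  simp only [trA, coef0, coef2, map_add, map_sub, map_mul, map_neg, map_pow, map_ofNat,
    aeval_X] at hT
  simp only [coef2, map_add, map_sub, map_mul, map_neg, map_pow, map_ofNat, aeval_X] at h2
  simp only [coef1, coef2, map_add, map_sub, map_mul, map_neg, map_pow, map_ofNat, aeval_X] at hν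
  have h2' : coef2 k p q n ≠ 0 := h2
  have hν' : coef1 k p q n ^ 3 + p * coef1 k p q n * coef2 k p q n ^ 2 + q * coef2 k p q n ^ 3 ≠ 0 :=
    hν
  refine ⟨hd, hS, hJ, hH, hT, h2', fun h => hν' ?_⟩
  have h3 : coef1 k p q n ^ 3 + p * coef1 k p q n * coef2 k p q n ^ 2 + q * coef2 k p q n ^ 3 =
      -coef2 k p q n ^ 2 * moebNu k p q n := by
    rw [moebNu, coef1_eq k p q n h2']
    ring
  rw [h3, h, mul_zero]

end Coordinates

end FourDimLinear

namespace FourDimLinear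

open IntermediateField

/-! ### The groups `G3` and `G6` -/

theorem isAlgebraic_of_le {k L : Type*} [Field k] [Field L] [Algebra k L]
    {E K : IntermediateField k L} (h : E ≤ K) [Algebra.IsAlgebraic E L] :
    Algebra.IsAlgebraic K L := by
  let := (inclusion h).toAlgebra
  have : IsScalarTower E K L := IsScalarTower.of_algebraMap_eq fun _ => rfl
  exact Algebra.IsAlgebraic.tower_top (K := E) K

/-- The coordinates of the Sylvester form of the generic quintic. -/
noncomputable def sylCoord : Fin 4 → RatFun4 :=
  ![sylK (e2 root / 10) (e3 root / 10) (e4 root / 5) (e5 root),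
    sylP (e2 root / 10) (e3 root / 10) (e4 root / 5) (e5 root),
    sylQ (e2 root / 10) (e3 root / 10) (e4 root / 5) (e5 root),
    sylN (e2 root / 10) (e3 root / 10) (e4 root / 5) (e5 root)]

theorem esymm_eq_mom :
    e2 root = 10 * mom2 (sylCoord 0) (sylCoord 1) (sylCoord 3) ∧
    e3 root = 10 * mom3 (sylCoord 0) (sylCoord 1) (sylCoord 2) (sylCoord 3) ∧
    e4 root = 5 * mom4 (sylCoord 0) (sylCoord 1) (sylCoord 2) (sylCoord 3) ∧
    e5 root = mom5 (sylCoord 0) (sylCoord 1) (sylCoord 2) (sylCoord 3) := by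
  have h10 : (10 : RatFun4) ≠ 0 := by norm_num
  have h5 : (5 : RatFun4) ≠ 0 := by norm_num
  obtain ⟨h2, h3, h4, h5'⟩ := mom_syl (e2 root / 10) (e3 root / 10) (e4 root / 5) (e5 root)
    (div_ne_zero e2_root_ne_zero h10) (fun h => hankel_ne_zero algebraicIndependent_esymm (by
      rw [hankel] at h
      field_simp at h
      linear_combination h / 5))
  refine ⟨?_, ?_, ?_, h5'.symm⟩
  · exact (mul_div_cancel₀ _ h10).symm.trans (congrArg (10 * ·) h2.symm)
  · exact (mul_div_cancel₀ _ h10).symm.trans (congrArg (10 * ·) h3.symm)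
  · exact (mul_div_cancel₀ _ h5).symm.trans (congrArg (5 * ·) h4.symm)

theorem esymm_mem {K : IntermediateField ℚ RatFun4} (h : ∀ i, sylCoord i ∈ K) :
    e2 root ∈ K ∧ e3 root ∈ K ∧ e4 root ∈ K ∧ e5 root ∈ K := by
  obtain ⟨h2, h3, h4, h5⟩ := esymm_eq_mom
  obtain ⟨m2, m3, m4, m5⟩ := mom_mem (h 0) (h 1) (h 2) (h 3)
  have hm (m : ℕ) [m.AtLeastTwo] : (OfNat.ofNat m : RatFun4) ∈ K := ofNat_mem K m
  exact ⟨h2 ▸ mul_mem (hm _) m2, h3 ▸ mul_mem (hm _) m3, h4 ▸ mul_mem (hm _) m4, h5 ▸ m5⟩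

theorem sylCoord_mem {K : IntermediateField ℚ RatFun4} (h2 : e2 root ∈ K) (h3 : e3 root ∈ K)
    (h4 : e4 root ∈ K) (h5 : e5 root ∈ K) (i : Fin 4) : sylCoord i ∈ K := by
  have hm (m : ℕ) [m.AtLeastTwo] : (OfNat.ofNat m : RatFun4) ∈ K := ofNat_mem K m
  obtain ⟨mk, mp, mq, mn⟩ := syl_mem _ _ _ _ (div_mem h2 (hm 10)) (div_mem h3 (hm 10))
    (div_mem h4 (hm 5)) h5
  fin_cases i
  exacts [mk, mp, mq, mn]

/-- The symmetric functions are polynomials in the Sylvester coordinates, so the whole function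
field is algebraic over the field that these four elements generate. -/
theorem algebraicIndependent_sylCoord :
    AlgebraicIndependent ℚ ![sylCoord 0, sylCoord 1, sylCoord 2, sylCoord 3] := by
  have := finite_G4
  have hle : fixedSubfield G4 ≤
      adjoin ℚ (Set.range ![sylCoord 0, sylCoord 1, sylCoord 2, sylCoord 3]) := by
    rw [fixedSubfield_G4, adjoin_le_iff]
    obtain ⟨m2, m3, m4, m5⟩ := esymm_mem (K := adjoin ℚ (Set.range
      ![sylCoord 0, sylCoord 1, sylCoord 2, sylCoord 3])) fun i =>
        subset_adjoin _ _ ⟨i, by fin_cases i <;> rfl⟩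
    rintro _ ⟨i, rfl⟩
    fin_cases i
    exacts [m2, m3, m4, m5]
  have := isAlgebraic_fixedSubfield G4
  exact algebraicIndependent_of_isAlgebraic _ (by simpa using four_le_trdeg)
    (isAlgebraic_of_le hle)

/-- The four generators of the field of invariants of `G3`. -/
noncomputable def genG3 : Fin 4 → RatFun4 :=
  gen (sylCoord 0) (sylCoord 1) (sylCoord 2) (sylCoord 3) (delta root)

theorem fixedSubfield_G3_eq_genG3 : fixedSubfield G3 = adjoin ℚ (Set.range genG3) := by
  obtain ⟨hd, hS, hJ, hH, hT, h2, hν⟩ :=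
    inv_ne_zero_of_algebraicIndependent algebraicIndependent_sylCoord
  have hD := delta_sq root e1_root
  obtain ⟨E2, E3, E4, E5⟩ := esymm_eq_mom
  rw [E2, E3, E4, E5, disc5_moments] at hD
  rw [fixedSubfield_G3]
  refine le_antisymm (adjoin_le_iff.2 ?_) (adjoin_le_iff.2 ?_)
  · obtain ⟨mk, mp, mq, mn, mD⟩ := rat_mem_of_gen_mem (sylCoord 0) (sylCoord 1) (sylCoord 2)
      (sylCoord 3) (delta root) hd hS hJ hH hT h2 hν hD
      (K := adjoin ℚ (Set.range genG3)) fun i => subset_adjoin _ _ ⟨i, rfl⟩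
    obtain ⟨m2, m3, m4, m5⟩ := esymm_mem (K := adjoin ℚ (Set.range genG3)) fun i => by
      fin_cases i
      exacts [mk, mp, mq, mn]
    rintro z (rfl | rfl | rfl | rfl | rfl)
    exacts [m2, m3, m4, m5, mD]
  · have hs (z : RatFun4) (hz : z ∈ ({e2 root, e3 root, e4 root, e5 root, delta root} :
        Set RatFun4)) : z ∈ adjoin ℚ {e2 root, e3 root, e4 root, e5 root, delta root} :=
      subset_adjoin _ _ hz
    have hc := sylCoord_mem (hs _ (by simp)) (hs _ (by simp)) (hs _ (by simp)) (hs _ (by simp))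
    rintro _ ⟨i, rfl⟩
    exact gen_mem _ _ _ _ _ (hc 0) (hc 1) (hc 2) (hc 3) (hs _ (by simp)) i

theorem isRational_G3 : IsRational ℚ (fixedSubfield G3) :=
  have : Finite G3 := by rw [G3_eq]; exact finite_range _
  isRational_of_eq_adjoin fixedSubfield_G3_eq_genG3

/-- `-1` negates `e3` and `e5` but fixes `Δ`, a product of ten differences. Hence it negates `k`,
`q` and, among the Möbius parameters, `μ` and `ν`. -/
theorem fieldAction_lam_genG3 :
    fieldAction lam (genG3 0) = genG3 0 ∧ fieldAction lam (genG3 1) = genG3 1 ∧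
      fieldAction lam (genG3 2) = genG3 2 ∧ fieldAction lam (genG3 3) = -genG3 3 := by
  obtain ⟨h2, h3, h4, h5, hΔ⟩ := fieldAction_signedStd_esymm 1 (-1)
  rw [← lam_eq_signedStd] at h2 h3 h4 h5 hΔ
  have hs : ((1 : ℤˣ) : ℤ) = 1 := rfl
  have hs' : ((-1 : ℤˣ) : ℤ) = -1 := rfl
  rw [hs', Int.cast_neg, Int.cast_one, neg_one_mul] at h3 h5
  rw [Equiv.Perm.sign_one, hs, Int.cast_one, one_mul] at hΔ
  obtain ⟨hk, hp, hq, hn⟩ := map_syl_of_odd (a := e2 root / 10) (b := e3 root / 10)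
    (c := e4 root / 5) (d := e5 root) (φ := (fieldAction lam : RatFun4 →+* RatFun4))
    (by simp [h2, map_ofNat]) (by simp [h3, map_ofNat, neg_div])
    (by simp [h4, map_ofNat]) h5
  exact map_gen_of_odd _ _ _ _ _ (φ := (fieldAction lam : RatFun4 →+* RatFun4)) hk hp hq hn hΔ

theorem fixedSubfield_G6_of_eq_adjoin {t : Fin 4 → RatFun4}
    (ht : fixedSubfield G3 = adjoin ℚ (Set.range t)) (l0 : fieldAction lam (t 0) = t 0)
    (l1 : fieldAction lam (t 1) = t 1) (l2 : fieldAction lam (t 2) = t 2)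
    (l3 : fieldAction lam (t 3) = -t 3) :
    fixedSubfield G6 = adjoin ℚ (Set.range ![t 0, t 1, t 2, t 3 ^ 2]) := by
  have hm (i : Fin 4) : ![t 0, t 1, t 2, t 3 ^ 2] i ∈
      adjoin ℚ (Set.range ![t 0, t 1, t 2, t 3 ^ 2]) := subset_adjoin _ _ ⟨i, rfl⟩
  have hfix (i : Fin 4) : ∀ g ∈ G3, fieldAction g (t i) = t i := by
    rw [← mem_fixedSubfield G3, ht]
    exact subset_adjoin _ _ ⟨i, rfl⟩
  have hG6 {x : RatFun4} (h3 : ∀ g ∈ G3, fieldAction g x = x) (hl : fieldAction lam x = x) :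
      ∀ g ∈ G6, fieldAction g x = x := by
    have hsub : G6 ≤ (MulAction.stabilizer (RatFun4 ≃ₐ[ℚ] RatFun4) x).comap fieldAction := by
      refine (Subgroup.closure_le _).2 ?_
      rintro _ (rfl | rfl | rfl)
      · exact h3 _ (Subgroup.subset_closure (by simp))
      · exact h3 _ (Subgroup.subset_closure (by simp))
      · exact hl
    exact fun g hg => hsub hg
  refine fixedSubfield_eq_adjoin (H := G3) ?_ ht.le ?_ (y := t 3)
    (hm 3) (g := lam) (Subgroup.subset_closure (by simp)) l3 ?_
  · exact Subgroup.closure_mono (by simp [Set.insert_subset_iff])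
  · intro i
    fin_cases i
    · exact hG6 (hfix 0) l0
    · exact hG6 (hfix 1) l1
    · exact hG6 (hfix 2) l2
    · change ∀ g ∈ G6, fieldAction g (t 3 ^ 2) = t 3 ^ 2
      refine hG6 (fun g hg => ?_) ?_
      · rw [map_pow, hfix 3 g hg]
      · rw [map_pow, l3, neg_sq]
  · rintro _ ⟨i, rfl⟩
    fin_cases i
    · exact ⟨_, hm 0, 0, zero_mem _, by simp⟩
    · exact ⟨_, hm 1, 0, zero_mem _, by simp⟩
    · exact ⟨_, hm 2, 0, zero_mem _, by simp⟩
    · exact ⟨0, zero_mem _, 1, one_mem _, by simp⟩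

theorem fixedSubfield_G6 : fixedSubfield G6 =
    adjoin ℚ (Set.range ![genG3 0, genG3 1, genG3 2, genG3 3 ^ 2]) := by
  obtain ⟨l0, l1, l2, l3⟩ := fieldAction_lam_genG3
  exact fixedSubfield_G6_of_eq_adjoin fixedSubfield_G3_eq_genG3 l0 l1 l2 l3

theorem isRational_G6 : IsRational ℚ (fixedSubfield G6) :=
  have : Finite G6 := by rw [G6_eq]; exact finite_range _
  isRational_of_eq_adjoin fixedSubfield_G6

end FourDimLinear

theorem theoremA1 (G : Subgroup FourDimLinear.GL4) :
    (Nonempty (G ≃* FourDimLinear.A5) ↔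
      FourDimLinear.AreConjugate G FourDimLinear.G3) ∧
    (Nonempty (G ≃* FourDimLinear.S5) ↔
      FourDimLinear.AreConjugate G FourDimLinear.G4 ∨
        FourDimLinear.AreConjugate G FourDimLinear.G5) ∧
    (Nonempty (G ≃* FourDimLinear.A5 × FourDimLinear.C2) ↔
      FourDimLinear.AreConjugate G FourDimLinear.G6) ∧
    (Nonempty (G ≃* FourDimLinear.S5 × FourDimLinear.C2) ↔
      FourDimLinear.AreConjugate G FourDimLinear.G7) ∧
    ((FourDimLinear.AreConjugate G FourDimLinear.G3 ∨
        FourDimLinear.AreConjugate G FourDimLinear.G4 ∨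
        FourDimLinear.AreConjugate G FourDimLinear.G5 ∨
        FourDimLinear.AreConjugate G FourDimLinear.G6 ∨
        FourDimLinear.AreConjugate G FourDimLinear.G7) →
      FourDimLinear.IsRational ℚ (FourDimLinear.fixedSubfield G)) := by
  refine ⟨FourDimLinear.equiv_A5_iff G, FourDimLinear.equiv_S5_iff G,
    FourDimLinear.equiv_A5_prod_iff G, FourDimLinear.equiv_S5_prod_iff G, ?_⟩
  rintro (h | h | h | h | h)
  · exact h.isRational FourDimLinear.isRational_G3
  · exact h.isRational FourDimLinear.isRational_G4
  · exact h.isRational FourDimLinear.isRational_G5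
  · exact h.isRational FourDimLinear.isRational_G6
  · exact h.isRational FourDimLinear.isRational_G7
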